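/- Let $\{e\}$ denote the $e$-th partial recursive function from $\mathbb N$ to $\mathbb N$ in a standard enumeration, and let $\langle\cdot,\cdot\rangle:\mathbb N^2\to\mathbb N$ be a recursive injective function. When $\{e\}(k)$ occurs in an assertion, it is part of the assertion that $\{e\}(k)$ is defined. Let $\mathcal L(R)$ be the language of first-order arithmetic expanded by a unary relation symbol $R$. The formulas of $\mathcal L(R)$ that are *positive* in $R$ are those in which $R$ does not appear, the atomic formulas $0\in R$, $1\in R$, $x_i\in R$, $(x_i+1)\in R$, $(x_i+x_j)\in R$, $(x_i\cdot x_j)\in R$, and those obtained from these by $\vee$, $\wedge$, $\exists$ and $\forall$. Let $\psi(y,R)$ be the formula of $\mathcal L(R)$ $$\exists a\,\exists x\,\exists e\,\Big( y=\langle a,x\rangle \wedge \big( [a=\langle 0,e\rangle \wedge x=e] \ \vee\ [a=\langle 1,e\rangle \wedge \exists t\,\forall s\ \langle \{e\}(\langle t,s\rangle),x\rangle\in R ]\big)\Big),$$ where the recursive relations $k=\langle i,j\rangle$ and the relation $\{e\}(k)=v$ are written out by formulas of arithmetic that define them in $\mathbb N$ and do not contain $R$. Then $\psi$ is positive in $R$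 (and expresses in $\mathbb N$ the displayed condition), and $\psi$ has no hyperarithmetical fixed point: there is no set $Q\subseteq\mathbb N$ that belongs to $L_{\omega_1^{CK}}$ and satisfies $y\in Q\iff\psi(y,Q)$ for all $y\in\mathbb N$. Here $L_\alpha$ is the $\alpha$-th level of the constructible hierarchy, and $\omega_1^{CK}$ is the least ordinal that is not the order type of a recursive well-ordering of a recursive set of natural numbers. -/

import Mathlib

namespace PosFix

open FirstOrder FirstOrder.Language

/-! ### Partial recursive functions -/

/-- `rfn e` is the `e`-th partial recursive function `{e}` from `ℕ` to `ℕ`. -/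
def rfn (e : ℕ) : ℕ →. ℕ :=
  (Denumerable.ofNat Nat.Partrec.Code e).eval

/-! ### First-order arithmetic, with and without a unary relation symbol -/

/-- The function symbols of first-order arithmetic: `0`, `1`, `+`, `·`. -/
inductive ArithFunc : ℕ → Type
  | zero : ArithFunc 0
  | one : ArithFunc 0
  | add : ArithFunc 2
  | mul : ArithFunc 2

/-- The relation symbol `<` of first-order arithmetic (equality is a logical symbol). -/
inductive ArithRel : ℕ → Type
  | lt : ArithRel 2

/-- The language of first-order arithmetic. -/
def arith : FirstOrder.Language.{0, 0} := ⟨ArithFunc, ArithRel⟩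

/-- The constant symbol `0` of `arith`. -/
def zeroSym : arith.Functions 0 := ArithFunc.zero

/-- The constant symbol `1` of `arith`. -/
def oneSym : arith.Functions 0 := ArithFunc.one

/-- The function symbol `+` of `arith`. -/
def addSym : arith.Functions 2 := ArithFunc.add

/-- The function symbol `·` of `arith`. -/
def mulSym : arith.Functions 2 := ArithFunc.mul

/-- The relation symbol `<` of `arith`. -/
def ltSym : arith.Relations 2 := ArithRel.lt

/-- A single unary relation symbol. -/
inductive UnaryRel : ℕ → Type
  | R : UnaryRel 1

/-- The language whose only symbol is a unary relation symbol. -/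
def unary : FirstOrder.Language.{0, 0} := ⟨fun _ => Empty, UnaryRel⟩

/-- The language of arithmetic expanded by a unary relation symbol `R`. -/
abbrev arithR : FirstOrder.Language.{0, 0} := arith.sum unary

/-- The relation symbol `R` of `arithR`. -/
def rSym : arithR.Relations 1 := Sum.inr UnaryRel.R

/-- The standard model of arithmetic. -/
instance standardModel : arith.Structure ℕ where
  funMap := fun {_} f =>
    match f with
    | ArithFunc.zero => fun _ => 0
    | ArithFunc.one => fun _ => 1
    | ArithFunc.add => fun v => v 0 + v 1
    | ArithFunc.mul => fun v => v 0 * v 1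
  RelMap := fun {_} r =>
    match r with
    | ArithRel.lt => fun v => v 0 < v 1

/-- The interpretation of the unary relation symbol by the set `Q`. -/
@[reducible]
def unaryModel (Q : Set ℕ) : unary.Structure ℕ where
  funMap := fun {_} f => Empty.elim f
  RelMap := fun {_} r =>
    match r with
    | UnaryRel.R => fun v => v 0 ∈ Q

/-- The standard model of arithmetic in which `R` is interpreted by the set `Q`. -/
@[reducible]
def modelR (Q : Set ℕ) : arithR.Structure ℕ :=
  letI := unaryModel Q
  FirstOrder.Language.sumStructure arith unary ℕ

/-- Formulas of arithmetic with free variables among `x₀, …, xₙ₋₁`. A quantifier binds the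
variable `xₙ`. -/
abbrev AForm (n : ℕ) := arith.BoundedFormula Empty n

/-- Formulas of the expanded language with free variables among `x₀, …, xₙ₋₁`. -/
abbrev RForm (n : ℕ) := arithR.BoundedFormula Empty n

/-- `φ(xs, Q)` holds in the standard model. -/
def Holds {n : ℕ} (φ : RForm n) (xs : Fin n → ℕ) (Q : Set ℕ) : Prop :=
  letI := modelR Q
  φ.Realize default xs

/-- A fixed point of `φ(x, R)` is a set `Q` with `y ∈ Q ↔ φ(y, Q)` for all `y`. -/
def IsFixedPoint (φ : RForm 1) (Q : Set ℕ) : Prop :=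
  ∀ y : ℕ, y ∈ Q ↔ Holds φ ![y] Q

/-! ### Terms and positive formulas -/

/-- Terms of arithmetic in the variables `x₀, …, xₙ₋₁`. -/
abbrev ATerm (n : ℕ) := arith.Term (Empty ⊕ Fin n)

/-- The term `xᵢ`. -/
def x {n : ℕ} (i : Fin n) : ATerm n := Term.var (Sum.inr i)

instance {n : ℕ} : Zero (ATerm n) := ⟨Constants.term zeroSym⟩
instance {n : ℕ} : One (ATerm n) := ⟨Constants.term oneSym⟩
instance {n : ℕ} : Add (ATerm n) := ⟨Functions.apply₂ addSym⟩
instance {n : ℕ} : Mul (ATerm n) := ⟨Functions.apply₂ mulSym⟩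

/-- The closed term `0 + 1 + ⋯ + 1` denoting `k`. -/
def numeral {n : ℕ} : ℕ → ATerm n
  | 0 => 0
  | k + 1 => numeral k + 1

/-- The formula `t ∈ R`. -/
def inR {n : ℕ} (t : ATerm n) : RForm n :=
  Relations.boundedFormula₁ rSym (LHom.sumInl.onTerm t)

/-- A formula of arithmetic, seen as a formula of the expanded language in which `R` does not
appear. -/
def noR {n : ℕ} (φ : AForm n) : RForm n := LHom.sumInl.onBoundedFormula φ

/-- The formulas that are positive in `R`. -/
inductive Positive : {n : ℕ} → RForm n → Prop
  | noR {n : ℕ} (φ : AForm n) : Positive (noR φ)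
  | zero {n : ℕ} : Positive (inR (0 : ATerm n))
  | one {n : ℕ} : Positive (inR (1 : ATerm n))
  | var {n : ℕ} (i : Fin n) : Positive (inR (x i))
  | succ {n : ℕ} (i : Fin n) : Positive (inR (x i + 1))
  | add {n : ℕ} (i j : Fin n) : Positive (inR (x i + x j))
  | mul {n : ℕ} (i j : Fin n) : Positive (inR (x i * x j))
  | or {n : ℕ} {φ χ : RForm n} : Positive φ → Positive χ → Positive (φ ⊔ χ)
  | and {n : ℕ} {φ χ : RForm n} : Positive φ → Positive χ → Positive (φ ⊓ χ)
  | ex {n : ℕ} {φ : RForm (n + 1)} : Positive φ → Positive φ.ex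
  | all {n : ℕ} {φ : RForm (n + 1)} : Positive φ → Positive φ.all

/-! ### An arithmetical formula for the graph of `(e, k) ↦ {e}(k)`

A variable `i` of a formula is called `i↟` below one more quantifier. -/

local postfix:max "↟" => Fin.castSucc

/-- `∃ z, φ(z)`, where `z` is the newly bound variable. -/
def exA {n : ℕ} (φ : Fin (n + 1) → AForm (n + 1)) : AForm n := (φ (Fin.last n)).ex

/-- `∀ z, φ(z)`, where `z` is the newly bound variable. -/
def allA {n : ℕ} (φ : Fin (n + 1) → AForm (n + 1)) : AForm n := (φ (Fin.last n)).all

/-- `s = t`. -/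
def eqA {n : ℕ} (s t : ATerm n) : AForm n := s.bdEqual t

/-- `s < t`. -/
def ltA {n : ℕ} (s t : ATerm n) : AForm n :=
  Relations.boundedFormula₂ ltSym s t

/-- `k = Nat.pair i j`. -/
def cantorF {n : ℕ} (i j k : Fin n) : AForm n :=
  (ltA (x i) (x j) ⊓ eqA (x k) (x j * x j + x i)) ⊔
    (∼(ltA (x i) (x j)) ⊓ eqA (x k) (x i * x i + x i + x j))

/-- `v = m mod ((i + 1) * d + 1)`: the number `v` is the `i`-th entry of the sequence coded by
`(m, d)` through Gödel's β function. -/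
def betaF {n : ℕ} (m d i v : Fin n) : AForm n :=
  ltA (x v) ((x i + 1) * x d + 1) ⊓
    exA fun q => eqA (x m↟) (x q * ((x i↟ + 1) * x d↟ + 1) + x v↟)

/-- The triple `(c, a, b)` is among the first `k` entries of the sequence coded by `(m, d)`. -/
def listedF {n : ℕ} (m d k c a b : Fin n) : AForm n :=
  exA fun i => exA fun u => exA fun w =>
    ltA (x i↟↟) (x k↟↟↟) ⊓
    (cantorF a↟↟↟ b↟↟↟ u↟ ⊓ (cantorF c↟↟↟ u↟ w ⊓ betaF m↟↟↟ d↟↟↟ i↟↟ w))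

/-- `c` codes one of the four initial functions, and its value at `a` is `b`. -/
def initialF {n : ℕ} (c a b : Fin n) : AForm n :=
  (eqA (x c) 0 ⊓ eqA (x b) 0) ⊔
  ((eqA (x c) (numeral 1) ⊓ eqA (x b) (x a + 1)) ⊔
  ((eqA (x c) (numeral 2) ⊓ exA fun z => cantorF b↟ z a↟) ⊔
  (eqA (x c) (numeral 3) ⊓ exA fun z => cantorF z b↟ a↟)))

/-- The value of `pair f g` at `a` is `b`, according to the listed triples. -/
def pairingF {n : ℕ} (m d k f g a b : Fin n) : AForm n :=
  exA fun u => exA fun v =>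
    cantorF u↟ v b↟↟ ⊓
    (listedF m↟↟ d↟↟ k↟↟ f↟↟ a↟↟ u↟ ⊓ listedF m↟↟ d↟↟ k↟↟ g↟↟ a↟↟ v)

/-- The value of `comp f g` at `a` is `b`, according to the listed triples. -/
def compositionF {n : ℕ} (m d k f g a b : Fin n) : AForm n :=
  exA fun u => listedF m↟ d↟ k↟ g↟ a↟ u ⊓ listedF m↟ d↟ k↟ f↟ u b↟

/-- The value of `prec f g`, which is coded by `c`, at `a` is `b`, according to the listed
triples. -/
def recursionF {n : ℕ} (m d k c f g a b : Fin n) : AForm n :=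
  (exA fun p => exA fun l =>
    cantorF p↟ l a↟↟ ⊓ (eqA (x l) 0 ⊓ listedF m↟↟ d↟↟ k↟↟ f↟↟ p↟ b↟↟)) ⊔
  (exA fun p => exA fun l => exA fun l' => exA fun a' => exA fun z => exA fun q => exA fun r =>
    cantorF p↟↟↟↟↟↟ l↟↟↟↟↟ a↟↟↟↟↟↟↟ ⊓
    (eqA (x l↟↟↟↟↟) (x l'↟↟↟↟ + 1) ⊓
    (cantorF p↟↟↟↟↟↟ l'↟↟↟↟ a'↟↟↟ ⊓
    (listedF m↟↟↟↟↟↟↟ d↟↟↟↟↟↟↟ k↟↟↟↟↟↟↟ c↟↟↟↟↟↟↟ a'↟↟↟ z↟↟ ⊓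
    (cantorF l'↟↟↟↟ z↟↟ q↟ ⊓
    (cantorF p↟↟↟↟↟↟ q↟ r ⊓
    listedF m↟↟↟↟↟↟↟ d↟↟↟↟↟↟↟ k↟↟↟↟↟↟↟ g↟↟↟↟↟↟↟ r b↟↟↟↟↟↟↟))))))

/-- The value of `rfind' f` at `a = (p, l)` is `b`, the least `b ≥ l` such that the value of `f`
at `(p, b)` is `0`, according to the listed triples. -/
def searchF {n : ℕ} (m d k f a b : Fin n) : AForm n :=
  exA fun p => exA fun l =>
    cantorF p↟ l a↟↟ ⊓
    (∼(ltA (x b↟↟) (x l)) ⊓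
    ((exA fun u => exA fun z =>
      cantorF p↟↟↟ b↟↟↟↟ u↟ ⊓
      (eqA (x z) 0 ⊓ listedF m↟↟↟↟ d↟↟↟↟ k↟↟↟↟ f↟↟↟↟ u↟ z)) ⊓
    (allA fun j =>
      (∼(ltA (x j) (x l↟)) ⊓ ltA (x j) (x b↟↟↟)) ⟹
        (exA fun u => exA fun z =>
          cantorF p↟↟↟↟ j↟↟ u↟ ⊓
          (ltA 0 (x z) ⊓ listedF m↟↟↟↟↟ d↟↟↟↟↟ k↟↟↟↟↟ f↟↟↟↟↟ u↟ z)))))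

/-- The assertion "the value of the function coded by `c` at `a` is `b`" follows from the listed
triples by one of the clauses that define this value. -/
def stepF {n : ℕ} (m d k c a b : Fin n) : AForm n :=
  initialF c a b ⊔
  ((exA fun f => exA fun g => exA fun q =>
    cantorF f↟↟ g↟ q ⊓
    ((eqA (x c↟↟↟) (numeral 4 * x q + numeral 4) ⊓
        pairingF m↟↟↟ d↟↟↟ k↟↟↟ f↟↟ g↟ a↟↟↟ b↟↟↟) ⊔
    ((eqA (x c↟↟↟) (numeral 4 * x q + numeral 6) ⊓
        compositionF m↟↟↟ d↟↟↟ k↟↟↟ f↟↟ g↟ a↟↟↟ b↟↟↟) ⊔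
    (eqA (x c↟↟↟) (numeral 4 * x q + numeral 5) ⊓
        recursionF m↟↟↟ d↟↟↟ k↟↟↟ c↟↟↟ f↟↟ g↟ a↟↟↟ b↟↟↟)))) ⊔
  (exA fun f =>
    eqA (x c↟) (numeral 4 * x f + numeral 7) ⊓ searchF m↟ d↟ k↟ f a↟ b↟))

/-- `{e}(a) = b`: there is a finite list of triples that contains `(e, a, b)`, and each triple of
the list follows from the list by one of the defining clauses. -/
def rfnF {n : ℕ} (e a b : Fin n) : AForm n :=
  exA fun m => exA fun d => exA fun k =>
    listedF m↟↟ d↟ k e↟↟↟ a↟↟↟ b↟↟↟ ⊓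
    (allA fun c' => allA fun a' => allA fun b' =>
      listedF m↟↟↟↟↟ d↟↟↟↟ k↟↟↟ c'↟↟ a'↟ b' ⟹ stepF m↟↟↟↟↟ d↟↟↟↟ k↟↟↟ c'↟↟ a'↟ b')

/-! ### The formula -/

/-- `k = ⟨i, j⟩`, where `p` is an index of the recursive pairing function `⟨·,·⟩`, that is,
`{p}(Nat.pair i j) = ⟨i, j⟩` for all `i`, `j`. -/
def pairF (p : ℕ) {n : ℕ} (i j k : Fin n) : AForm n :=
  exA fun c => exA fun u =>
    eqA (x c↟) (numeral p) ⊓ (cantorF i↟↟ j↟↟ u ⊓ rfnF c↟ u k↟↟)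

/-- `∃ z, φ(z)` in the expanded language, where `z` is the newly bound variable. -/
def exR {n : ℕ} (φ : Fin (n + 1) → RForm (n + 1)) : RForm n := (φ (Fin.last n)).ex

/-- `∀ z, φ(z)` in the expanded language, where `z` is the newly bound variable. -/
def allR {n : ℕ} (φ : Fin (n + 1) → RForm (n + 1)) : RForm n := (φ (Fin.last n)).all

/-- The formula `ψ(y, R)`, where `⟨·,·⟩` is the recursive pairing function with index `p`:
there are `a, b, e` with `y = ⟨a, b⟩` such that either `a = ⟨0, e⟩` and `b = e`, or
`a = ⟨1, e⟩` and `∃ t, ∀ s, ⟨{e}(⟨t, s⟩), b⟩ ∈ R`. -/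
def psi (p : ℕ) : RForm 1 :=
  exR fun a => exR fun b => exR fun e =>
    noR (pairF p a↟↟ b↟ 0) ⊓
    ((noR (exA fun z => eqA (x z) 0 ⊓ pairF p z e↟ a↟↟↟) ⊓ noR (eqA (x b↟) (x e))) ⊔
    (noR (exA fun z => eqA (x z) 1 ⊓ pairF p z e↟ a↟↟↟) ⊓
      exR fun t => allR fun s => exR fun u => exR fun v => exR fun w =>
        noR (pairF p t↟↟↟↟ s↟↟↟ u↟↟) ⊓
        (noR (rfnF e↟↟↟↟↟ u↟↟ v↟) ⊓
        (noR (pairF p v↟ b↟↟↟↟↟↟ w) ⊓ inR (x w)))))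

/-! ### The constructible hierarchy up to the first non-recursive ordinal -/

/-- The relation symbol `∈` of set theory. -/
inductive MemRel : ℕ → Type
  | mem : MemRel 2

/-- The language of set theory. -/
def setLang : FirstOrder.Language.{0, 0} := ⟨fun _ => Empty, MemRel⟩

/-- The structure `(A, ∈)`. -/
instance memModel (A : ZFSet.{0}) : setLang.Structure {z : ZFSet.{0} // z ∈ A} where
  funMap := fun {_} f => Empty.elim f
  RelMap := fun {_} r =>
    match r with
    | MemRel.mem => fun v => (v 0 : ZFSet.{0}) ∈ (v 1 : ZFSet.{0})

/-- The set of all subsets of `A` that are first-order definable over `(A, ∈)` with parameters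
from `A`. -/
noncomputable def definablePowerset (A : ZFSet.{0}) : ZFSet.{0} :=
  ZFSet.sep
    (fun s => (Set.univ : Set {z : ZFSet.{0} // z ∈ A}).Definable₁ setLang
      {z : {z : ZFSet.{0} // z ∈ A} | (z : ZFSet.{0}) ∈ s})
    A.powerset

/-- The constructible hierarchy: `L₀ = ∅`, `L_{α+1}` consists of the definable subsets of `L_α`,
and `L_α` is the union of all `L_β`, `β < α`, for a limit ordinal `α`. -/
noncomputable def constructible (α : Ordinal.{0}) : ZFSet.{0} :=
  Ordinal.limitRecOn (motive := fun _ => ZFSet.{0}) α ∅ (fun _ A => definablePowerset A)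
    (fun l _ A => ZFSet.iUnion fun β : Set.Iio l => A β.1 β.2)

/-- An ordinal is recursive if it is the order type of a recursive well-ordering of a recursive
set of natural numbers. -/
def IsRecursiveOrdinal (α : Ordinal.{0}) : Prop :=
  ∃ (D : Set ℕ) (r : ℕ → ℕ → Prop),
    ComputablePred (fun n : ℕ => n ∈ D) ∧
    ComputablePred (fun q : ℕ × ℕ => r q.1 q.2) ∧
    ∃ wo : IsWellOrder D (fun a b : D => r a b),
      @Ordinal.type D (fun a b : D => r a b) wo = α

/-- `ω₁^CK`, the least non-recursive ordinal. -/
noncomputable def omegaOneCK : Ordinal.{0} :=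
  sInf {α : Ordinal.{0} | ¬ IsRecursiveOrdinal α}

/-- A set of natural numbers as a set of von Neumann natural numbers. -/
noncomputable def natSet (Q : Set ℕ) : ZFSet.{0} :=
  ZFSet.range fun n : Q => Ordinal.toZFSet ((n : ℕ) : Ordinal.{0})

/-- `Q` is hyperarithmetical: it belongs to `L_α` for `α = ω₁^CK`. -/
def Hyperarithmetical (Q : Set ℕ) : Prop :=
  natSet Q ∈ constructible omegaOneCK

end PosFix

/-!
That `psi p` expresses the displayed condition comes down to the formula for the graph of
`(e, k) ↦ {e}(k)`. A computation is witnessed by a finite set of triples `(e, k, v)`, each of which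
follows from that set by a clause of the definition of `Nat.Partrec.Code.eval`, and finite sets are
coded by Gödel's β function (`realize_rfnF`).

Let `Q` be a fixed point, and call `{b | pr a b ∈ Q}` the section of `Q` with code `a`. Sections
include the singletons and are closed under recursive unions of recursive intersections. The
recursion theorem therefore gives codes for the sentences of any computable tree of infinitary
propositional sentences: a true sentence gets the section `ℕ`, a false one the section `∅`, as long
as the sentence is well-founded (`exists_sections`).

Truth in a level `L_β` with recursive `β` is given by such sentences. With a recursive
well-ordering of type `β`, the elements of `L_β` have names, which consist of a level, a formula,
and names of lower level for the parameters; satisfaction, membership and equality of names unfold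
recursively into each other (`child`), and this unfolding is well-founded (`decides_satN`). A
hyperarithmetical set is definable over some `L_β` with `β` recursive, and the natural numbers are
defined in `L_β` by formulas that can be computed, so membership in a hyperarithmetical set is
expressed by a computable sequence of sentences (`Hyperarithmetical.exists_sentences`).

If a fixed point `Q` were hyperarithmetical, the diagonal set `{t | pr t t ∉ Q}` would be a section
of `Q` (`exists_diagonal_section`), and its code `a` would satisfy `pr a a ∈ Q ↔ pr a a ∉ Q`.
-/

namespace PosFix

open FirstOrder FirstOrder.Language

/-! ### The formulas of arithmetic in the standard model -/

section Realize

variable {n : ℕ} {v : Empty → ℕ} {xs : Fin n → ℕ}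

@[simp] theorem realize_x (i : Fin n) : (x i).realize (Sum.elim v xs) = xs i := rfl

@[simp] theorem realize_zero : (0 : ATerm n).realize (Sum.elim v xs) = 0 := rfl

@[simp] theorem realize_one : (1 : ATerm n).realize (Sum.elim v xs) = 1 := rfl

@[simp] theorem realize_add (s t : ATerm n) :
    (s + t).realize (Sum.elim v xs) =
      s.realize (Sum.elim v xs) + t.realize (Sum.elim v xs) := rfl

@[simp] theorem realize_mul (s t : ATerm n) :
    (s * t).realize (Sum.elim v xs) =
      s.realize (Sum.elim v xs) * t.realize (Sum.elim v xs) := rfl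

@[simp] theorem realize_numeral (k : ℕ) :
    (numeral k : ATerm n).realize (Sum.elim v xs) = k := by
  induction k with
  | zero => rfl
  | succ k ih => simp [numeral, ih]

@[simp] theorem realize_eqA (s t : ATerm n) :
    (eqA s t).Realize v xs ↔ s.realize (Sum.elim v xs) = t.realize (Sum.elim v xs) :=
  Iff.rfl

@[simp] theorem realize_ltA (s t : ATerm n) :
    (ltA s t).Realize v xs ↔ s.realize (Sum.elim v xs) < t.realize (Sum.elim v xs) :=
  Iff.rfl

@[simp] theorem realize_exA (φ : Fin (n + 1) → AForm (n + 1)) :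
    (exA φ).Realize v xs ↔ ∃ a, (φ (Fin.last n)).Realize v (Fin.snoc xs a) :=
  BoundedFormula.realize_ex

@[simp] theorem realize_allA (φ : Fin (n + 1) → AForm (n + 1)) :
    (allA φ).Realize v xs ↔ ∀ a, (φ (Fin.last n)).Realize v (Fin.snoc xs a) :=
  Iff.rfl

@[simp] theorem realize_cantorF (i j k : Fin n) :
    (cantorF i j k).Realize v xs ↔ xs k = Nat.pair (xs i) (xs j) := by
  by_cases h : xs i < xs j <;> simp [cantorF, Nat.pair, h]

@[simp] theorem realize_betaF (m d i w : Fin n) :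
    (betaF m d i w).Realize v xs ↔ xs w = xs m % ((xs i + 1) * xs d + 1) := by
  simp only [betaF, BoundedFormula.realize_inf, realize_ltA, realize_exA, realize_eqA,
    realize_x, realize_add, realize_mul, realize_one, Fin.snoc_castSucc, Fin.snoc_last]
  constructor
  · rintro ⟨h, q, hq⟩
    rw [hq, add_comm, Nat.add_mul_mod_self_right, Nat.mod_eq_of_lt h]
  · intro h
    refine ⟨h ▸ Nat.mod_lt _ (Nat.succ_pos _), xs m / ((xs i + 1) * xs d + 1), ?_⟩
    rw [h, Nat.div_add_mod']

/-- The triple `(c, a, b)` is among the first `k` entries of the sequence coded by `(m, d)`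
through Gödel's β function. -/
def Listed (m d k c a b : ℕ) : Prop :=
  ∃ i < k, Nat.pair c (Nat.pair a b) = m % ((i + 1) * d + 1)

@[simp] theorem realize_listedF (m d k c a b : Fin n) :
    (listedF m d k c a b).Realize v xs ↔ Listed (xs m) (xs d) (xs k) (xs c) (xs a) (xs b) := by
  simp [listedF, Listed]

/-- The assertion "the value of the function coded by `c` at `a` is `b`" follows from the
assertions in `S` by one of the defining clauses of `Nat.Partrec.Code.eval`. -/
def Step (S : ℕ → ℕ → ℕ → Prop) (c a b : ℕ) : Prop :=
  ((c = 0 ∧ b = 0) ∨ (c = 1 ∧ b = a + 1) ∨ (c = 2 ∧ ∃ z, a = Nat.pair b z) ∨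
    (c = 3 ∧ ∃ z, a = Nat.pair z b)) ∨
  (∃ f g, (c = 4 * Nat.pair f g + 4 ∧ ∃ u w, b = Nat.pair u w ∧ S f a u ∧ S g a w) ∨
    (c = 4 * Nat.pair f g + 6 ∧ ∃ u, S g a u ∧ S f u b) ∨
    (c = 4 * Nat.pair f g + 5 ∧
      ((∃ p, a = Nat.pair p 0 ∧ S f p b) ∨
        ∃ p l z, a = Nat.pair p (l + 1) ∧ S c (Nat.pair p l) z ∧
          S g (Nat.pair p (Nat.pair l z)) b))) ∨
  ∃ f, c = 4 * f + 7 ∧ ∃ p l, a = Nat.pair p l ∧ l ≤ b ∧ S f (Nat.pair p b) 0 ∧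
    ∀ j, l ≤ j → j < b → ∃ z, 0 < z ∧ S f (Nat.pair p j) z

@[simp] theorem realize_stepF (m d k c a b : Fin n) :
    (stepF m d k c a b).Realize v xs ↔
      Step (Listed (xs m) (xs d) (xs k)) (xs c) (xs a) (xs b) := by
  simp [stepF, Step, initialF, pairingF, compositionF, recursionF, searchF]

end Realize

/-! ### The graph of the universal function -/

theorem Step.mono {S T : ℕ → ℕ → ℕ → Prop} (h : ∀ c a b, S c a b → T c a b) {c a b : ℕ}
    (hs : Step S c a b) : Step T c a b := by
  rcases hs with h0 | ⟨f, g, ⟨rfl, u, w, rfl, h1, h2⟩ | ⟨rfl, u, h1, h2⟩ |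
    ⟨rfl, ⟨p, rfl, h1⟩ | ⟨p, l, z, rfl, h1, h2⟩⟩⟩ | ⟨f, rfl, p, l, rfl, hl, h1, h2⟩
  · exact Or.inl h0
  · exact Or.inr (Or.inl ⟨f, g, Or.inl ⟨rfl, u, w, rfl, h _ _ _ h1, h _ _ _ h2⟩⟩)
  · exact Or.inr (Or.inl ⟨f, g, Or.inr (Or.inl ⟨rfl, u, h _ _ _ h1, h _ _ _ h2⟩)⟩)
  · exact Or.inr (Or.inl ⟨f, g, Or.inr (Or.inr ⟨rfl, Or.inl ⟨p, rfl, h _ _ _ h1⟩⟩)⟩)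
  · exact Or.inr (Or.inl ⟨f, g, Or.inr (Or.inr
      ⟨rfl, Or.inr ⟨p, l, z, rfl, h _ _ _ h1, h _ _ _ h2⟩⟩)⟩)
  · refine Or.inr (Or.inr ⟨f, rfl, p, l, rfl, hl, h _ _ _ h1, fun j h3 h4 => ?_⟩)
    obtain ⟨z, hz, h5⟩ := h2 j h3 h4
    exact ⟨z, hz, h _ _ _ h5⟩

open Nat.Partrec

theorem mem_eval_rfind' {f : Code} {p l b : ℕ} :
    b ∈ f.rfind'.eval (Nat.pair p l) ↔ l ≤ b ∧ 0 ∈ f.eval (Nat.pair p b) ∧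
      ∀ j, l ≤ j → j < b → ∃ z, 0 < z ∧ z ∈ f.eval (Nat.pair p j) := by
  simp only [Code.eval, Nat.unpaired, Nat.unpair_pair, Part.mem_map_iff]
  constructor
  · rintro ⟨k, h, rfl⟩
    obtain ⟨h1, h2⟩ := Nat.mem_rfind.1 h
    refine ⟨Nat.le_add_left _ _, by simpa using h1, fun j hj hjk => ?_⟩
    obtain ⟨z, hz, hz0⟩ := (Part.mem_map_iff _).1 (h2 (show j - l < k by omega))
    rw [Nat.sub_add_cancel hj] at hz
    exact ⟨z, by simpa [Nat.pos_iff_ne_zero] using hz0, hz⟩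
  · rintro ⟨hl, h1, h2⟩
    refine ⟨b - l, Nat.mem_rfind.2 ⟨?_, fun {j} hj => ?_⟩, Nat.sub_add_cancel hl⟩
    · simpa [Nat.sub_add_cancel hl] using h1
    · obtain ⟨z, hz, hz'⟩ := h2 (j + l) (by omega) (by omega)
      exact (Part.mem_map_iff _).2 ⟨z, hz', by simpa using hz.ne'⟩

theorem mem_eval_pair {f g : Code} {a b : ℕ} :
    b ∈ (f.pair g).eval a ↔ ∃ u ∈ f.eval a, ∃ w ∈ g.eval a, Nat.pair u w = b := by
  simp [Code.eval, Seq.seq]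

/-- A set of triples each of which follows from that set by one of the clauses contains only
true assertions. No well-foundedness has to be assumed, since the clauses refer to subcodes,
or to the same code at a smaller argument of the recursion. -/
theorem mem_eval_of_step {S : ℕ → ℕ → ℕ → Prop} (hS : ∀ c a b, S c a b → Step S c a b)
    (c : Code) : ∀ a b, S (Code.encodeCode c) a b → b ∈ c.eval a := by
  induction c with
  | zero =>
    intro a b h
    replace h := hS _ _ _ h
    rcases h with h | ⟨f, g, ⟨h, -⟩ | ⟨h, -⟩ | ⟨h, -⟩⟩ | ⟨f, h, -⟩ <;>
      simp [Code.encodeCode] at h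
    simp [Code.eval, h, pure, PFun.pure]
  | succ =>
    intro a b h
    replace h := hS _ _ _ h
    rcases h with h | ⟨f, g, ⟨h, -⟩ | ⟨h, -⟩ | ⟨h, -⟩⟩ | ⟨f, h, -⟩ <;>
      simp [Code.encodeCode] at h
    simp [Code.eval, h]
  | left =>
    intro a b h
    replace h := hS _ _ _ h
    rcases h with h | ⟨f, g, ⟨h, -⟩ | ⟨h, -⟩ | ⟨h, -⟩⟩ | ⟨f, h, -⟩ <;>
      simp [Code.encodeCode] at h
    obtain ⟨z, rfl⟩ := h
    simp [Code.eval]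
  | right =>
    intro a b h
    replace h := hS _ _ _ h
    rcases h with h | ⟨f, g, ⟨h, -⟩ | ⟨h, -⟩ | ⟨h, -⟩⟩ | ⟨f, h, -⟩ <;>
      simp [Code.encodeCode] at h
    obtain ⟨z, rfl⟩ := h
    simp [Code.eval]
  | pair cf cg ihf ihg =>
    intro a b h
    replace h := hS _ _ _ h
    rcases h with h | ⟨f, g, ⟨h, u, w, rfl, h1, h2⟩ | ⟨h, -⟩ | ⟨h, -⟩⟩ | ⟨f, h, -⟩ <;>
      simp only [Code.encodeCode] at h <;> try omega
    obtain ⟨rfl, rfl⟩ := Nat.pair_eq_pair.1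
      (show Nat.pair f g = Nat.pair cf.encodeCode cg.encodeCode by omega)
    exact mem_eval_pair.2 ⟨u, ihf _ _ h1, w, ihg _ _ h2, rfl⟩
  | comp cf cg ihf ihg =>
    intro a b h
    replace h := hS _ _ _ h
    rcases h with h | ⟨f, g, ⟨h, -⟩ | ⟨h, u, h1, h2⟩ | ⟨h, -⟩⟩ | ⟨f, h, -⟩ <;>
      simp only [Code.encodeCode] at h <;> try omega
    obtain ⟨rfl, rfl⟩ := Nat.pair_eq_pair.1
      (show Nat.pair f g = Nat.pair cf.encodeCode cg.encodeCode by omega)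
    exact Part.mem_bind_iff.2 ⟨u, ihg _ _ h1, ihf _ _ h2⟩
  | prec cf cg ihf ihg =>
    intro a
    obtain ⟨p, l, rfl⟩ : ∃ p l, a = Nat.pair p l := ⟨_, _, (Nat.pair_unpair a).symm⟩
    induction l with
    | zero =>
      intro b h
      replace h := hS _ _ _ h
      rcases h with h | ⟨f, g, ⟨h, -⟩ | ⟨h, -⟩ |
          ⟨h, ⟨p', e, h1⟩ | ⟨p', l', z, e, h1, h2⟩⟩⟩ | ⟨f, h, -⟩ <;>
        simp only [Code.encodeCode] at h <;> try omega
      · obtain ⟨rfl, rfl⟩ := Nat.pair_eq_pair.1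
          (show Nat.pair f g = Nat.pair cf.encodeCode cg.encodeCode by omega)
        obtain ⟨rfl, -⟩ := Nat.pair_eq_pair.1 e
        rw [Code.eval_prec_zero]
        exact ihf _ _ h1
      · exact absurd (Nat.pair_eq_pair.1 e).2 (Nat.succ_ne_zero _).symm
    | succ l ihl =>
      intro b h
      replace h := hS _ _ _ h
      rcases h with h | ⟨f, g, ⟨h, -⟩ | ⟨h, -⟩ |
          ⟨h, ⟨p', e, h1⟩ | ⟨p', l', z, e, h1, h2⟩⟩⟩ | ⟨f, h, -⟩ <;>
        simp only [Code.encodeCode] at h <;> try omega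
      · exact absurd (Nat.pair_eq_pair.1 e).2 (Nat.succ_ne_zero _)
      · obtain ⟨rfl, rfl⟩ := Nat.pair_eq_pair.1
          (show Nat.pair f g = Nat.pair cf.encodeCode cg.encodeCode by omega)
        obtain ⟨rfl, e⟩ := Nat.pair_eq_pair.1 e
        obtain rfl : l = l' := by omega
        rw [Code.eval_prec_succ]
        exact Part.mem_bind_iff.2 ⟨z, ihl _ h1, ihg _ _ h2⟩
  | rfind' cf ihf =>
    intro a b h
    replace h := hS _ _ _ h
    rcases h with h | ⟨f, g, ⟨h, -⟩ | ⟨h, -⟩ | ⟨h, -⟩⟩ |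
        ⟨f, h, p, l, rfl, hl, h1, h2⟩ <;>
      simp only [Code.encodeCode] at h <;> try omega
    obtain rfl : f = cf.encodeCode := by omega
    refine mem_eval_rfind'.2 ⟨hl, ihf _ _ h1, fun j hj hjb => ?_⟩
    obtain ⟨z, hz, h3⟩ := h2 j hj hjb
    exact ⟨z, hz, ihf _ _ h3⟩

/-- The triple `(c, a, b)` belongs to a finite set of triples each of which follows from that set
by one of the clauses. -/
def FinitelySupported (c a b : ℕ) : Prop :=
  ∃ S : Set (ℕ × ℕ × ℕ), S.Finite ∧ (c, a, b) ∈ S ∧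
    ∀ c a b, (c, a, b) ∈ S → Step (fun c a b => (c, a, b) ∈ S) c a b

theorem FinitelySupported.of_step {c a b : ℕ} {T : Set (ℕ × ℕ × ℕ)} (hT : T.Finite)
    (h : Step (fun c a b => (c, a, b) ∈ T) c a b)
    (hs : ∀ q ∈ T, FinitelySupported q.1 q.2.1 q.2.2) : FinitelySupported c a b := by
  choose! S hS hmem hstep using hs
  have hle : ∀ q ∈ T, q ∈ insert (c, a, b) (⋃ q ∈ T, S q) := fun q hq =>
    Or.inr (Set.mem_biUnion hq (hmem q hq))
  refine ⟨insert (c, a, b) (⋃ q ∈ T, S q), (hT.biUnion hS).insert _, Or.inl rfl, ?_⟩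
  rintro c' a' b' (h' | h')
  · simp only [Prod.mk.injEq] at h'
    obtain ⟨rfl, rfl, rfl⟩ := h'
    exact h.mono fun _ _ _ hq => hle _ hq
  · obtain ⟨q, hq, h'⟩ := Set.mem_iUnion₂.1 h'
    exact (hstep q hq _ _ _ h').mono fun _ _ _ h3 => Or.inr (Set.mem_biUnion hq h3)

theorem finitelySupported_of_mem_eval (c : Code) :
    ∀ a b, b ∈ c.eval a → FinitelySupported (Code.encodeCode c) a b := by
  induction c with
  | zero =>
    intro a b h
    have h : b = 0 := by simpa [Code.eval, pure, PFun.pure] using h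
    exact .of_step Set.finite_empty (by simp [Step, Code.encodeCode, h]) (by simp)
  | succ =>
    intro a b h
    have h : b = a + 1 := by simpa [Code.eval] using h
    exact .of_step Set.finite_empty (by simp [Step, Code.encodeCode, h]) (by simp)
  | left =>
    intro a b h
    have h : b = a.unpair.1 := by simpa [Code.eval] using h
    exact .of_step Set.finite_empty
      (Or.inl (Or.inr (Or.inr (Or.inl ⟨rfl, a.unpair.2, by simp [h]⟩)))) (by simp)
  | right =>
    intro a b h
    have h : b = a.unpair.2 := by simpa [Code.eval] using h
    exact .of_step Set.finite_empty
      (Or.inl (Or.inr (Or.inr (Or.inr ⟨rfl, a.unpair.1, by simp [h]⟩)))) (by simp)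
  | pair cf cg ihf ihg =>
    intro a b h
    obtain ⟨u, hu, w, hw, rfl⟩ := mem_eval_pair.1 h
    refine .of_step (T := {(cf.encodeCode, a, u), (cg.encodeCode, a, w)}) (Set.toFinite _)
      (Or.inr (Or.inl ⟨cf.encodeCode, cg.encodeCode, Or.inl
        ⟨by simp only [Code.encodeCode]; ring, u, w, rfl, by simp, by simp⟩⟩)) ?_
    rintro q (rfl | rfl)
    exacts [ihf _ _ hu, ihg _ _ hw]
  | comp cf cg ihf ihg =>
    intro a b h
    obtain ⟨u, hu, hb⟩ := Part.mem_bind_iff.1 h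
    refine .of_step (T := {(cg.encodeCode, a, u), (cf.encodeCode, u, b)}) (Set.toFinite _)
      (Or.inr (Or.inl ⟨cf.encodeCode, cg.encodeCode, Or.inr (Or.inl
        ⟨by simp only [Code.encodeCode]; ring, u, by simp, by simp⟩)⟩)) ?_
    rintro q (rfl | rfl)
    exacts [ihg _ _ hu, ihf _ _ hb]
  | prec cf cg ihf ihg =>
    intro a
    obtain ⟨p, l, rfl⟩ : ∃ p l, a = Nat.pair p l := ⟨_, _, (Nat.pair_unpair a).symm⟩
    induction l with
    | zero =>
      intro b h
      rw [Code.eval_prec_zero] at h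
      refine .of_step (T := {(cf.encodeCode, p, b)}) (Set.toFinite _)
        (Or.inr (Or.inl ⟨cf.encodeCode, cg.encodeCode, Or.inr (Or.inr
          ⟨by simp only [Code.encodeCode]; ring, Or.inl ⟨p, rfl, rfl⟩⟩)⟩)) ?_
      rintro q rfl
      exact ihf _ _ h
    | succ l ihl =>
      intro b h
      rw [Code.eval_prec_succ] at h
      obtain ⟨z, hz, hb⟩ := Part.mem_bind_iff.1 h
      refine .of_step (T := {((cf.prec cg).encodeCode, Nat.pair p l, z),
          (cg.encodeCode, Nat.pair p (Nat.pair l z), b)}) (Set.toFinite _)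
        (Or.inr (Or.inl ⟨cf.encodeCode, cg.encodeCode, Or.inr (Or.inr
          ⟨by simp only [Code.encodeCode]; ring,
            Or.inr ⟨p, l, z, rfl, by simp, by simp⟩⟩)⟩)) ?_
      rintro q (rfl | rfl)
      exacts [ihl _ hz, ihg _ _ hb]
  | rfind' cf ihf =>
    intro a b h
    obtain ⟨p, l, rfl⟩ : ∃ p l, a = Nat.pair p l := ⟨_, _, (Nat.pair_unpair a).symm⟩
    obtain ⟨hl, h1, h2⟩ := mem_eval_rfind'.1 h
    choose! z hz h3 using h2
    refine .of_step (T := insert (cf.encodeCode, Nat.pair p b, 0)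
        ((fun j => (cf.encodeCode, Nat.pair p j, z j)) '' Set.Ico l b))
      (((Set.finite_Ico l b).image _).insert _)
      (Or.inr (Or.inr ⟨cf.encodeCode, by simp only [Code.encodeCode]; ring, p, l, rfl, hl,
        Or.inl rfl, fun j hj hjb => ⟨z j, hz j hj hjb, Or.inr ⟨j, ⟨hj, hjb⟩, rfl⟩⟩⟩)) ?_
    rintro q (rfl | ⟨j, ⟨hj, hjb⟩, rfl⟩)
    exacts [ihf _ _ h1, ihf _ _ (h3 j hj hjb)]

/-- Every finite set of triples is the set of entries of a sequence coded by Gödel's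
β function. -/
theorem exists_listed {S : Set (ℕ × ℕ × ℕ)} (hS : S.Finite) :
    ∃ m d k, ∀ c a b, Listed m d k c a b ↔ (c, a, b) ∈ S := by
  let l := hS.toFinset.toList.map fun q => Nat.pair q.1 (Nat.pair q.2.1 q.2.2)
  refine ⟨(Nat.unbeta l).unpair.1, (Nat.unbeta l).unpair.2, l.length, fun c a b => ?_⟩
  have key : Listed (Nat.unbeta l).unpair.1 (Nat.unbeta l).unpair.2 l.length c a b ↔
      Nat.pair c (Nat.pair a b) ∈ l := by
    rw [List.mem_iff_getElem]
    constructor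
    · rintro ⟨i, hi, h⟩
      exact ⟨i, hi, ((Nat.beta_unbeta_coe l ⟨i, hi⟩).symm.trans h.symm)⟩
    · rintro ⟨i, hi, h⟩
      exact ⟨i, hi, h.symm.trans (Nat.beta_unbeta_coe l ⟨i, hi⟩).symm⟩
  rw [key]
  simp only [l, List.mem_map, Finset.mem_toList, Set.Finite.mem_toFinset, Nat.pair_eq_pair]
  constructor
  · rintro ⟨⟨c', a', b'⟩, h, rfl, rfl, rfl⟩
    exact h
  · exact fun h => ⟨_, h, rfl, rfl, rfl⟩

@[simp] theorem realize_rfnF {n : ℕ} {v : Empty → ℕ} {xs : Fin n → ℕ} (e a b : Fin n) :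
    (rfnF e a b).Realize v xs ↔ xs b ∈ rfn (xs e) (xs a) := by
  obtain ⟨c, hc⟩ : ∃ c : Code, Code.encodeCode c = xs e :=
    ⟨Denumerable.ofNat Code (xs e), Denumerable.encode_ofNat (α := Code) (xs e)⟩
  have hr : rfn (xs e) = c.eval := by
    rw [rfn, ← hc]
    exact congrArg Code.eval (Denumerable.ofNat_encode c)
  rw [hr]
  simp only [rfnF, realize_exA, BoundedFormula.realize_inf, realize_listedF, realize_allA,
    BoundedFormula.realize_imp, realize_stepF, Fin.snoc_castSucc, Fin.snoc_last]
  constructor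
  · rintro ⟨m, d, k, h, hstep⟩
    rw [← hc] at h
    exact mem_eval_of_step hstep c _ _ h
  · intro h
    obtain ⟨S, hfin, hmem, hstep⟩ := finitelySupported_of_mem_eval c _ _ h
    obtain ⟨m, d, k, hl⟩ := exists_listed hfin
    have hl' : Listed m d k = fun c a b => (c, a, b) ∈ S := by
      funext c a b
      exact propext (hl c a b)
    refine ⟨m, d, k, ?_⟩
    rw [hl', ← hc]
    exact ⟨hmem, hstep⟩

/-! ### The formula `psi` -/

theorem positive_psi (p : ℕ) : Positive (psi p) :=
  .ex (.ex (.ex (.and (.noR _) (.or (.and (.noR _) (.noR _)) (.and (.noR _)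
    (.ex (.all (.ex (.ex (.ex (.and (.noR _) (.and (.noR _) (.and (.noR _) (.var _))))))))))))))

theorem holds_psi {pr : ℕ → ℕ → ℕ} {p : ℕ}
    (hp : ∀ i j : ℕ, rfn p (Nat.pair i j) = Part.some (pr i j)) (y : ℕ) (Q : Set ℕ) :
    Holds (psi p) ![y] Q ↔
      ∃ a b e : ℕ, y = pr a b ∧
        ((a = pr 0 e ∧ b = e) ∨
          (a = pr 1 e ∧ ∃ t : ℕ, ∀ s : ℕ, ∃ w ∈ rfn e (pr t s), pr w b ∈ Q)) := by
  have hpF : ∀ {n : ℕ} {v : Empty → ℕ} {xs : Fin n → ℕ} (i j k : Fin n),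
      (pairF p i j k).Realize v xs ↔ xs k = pr (xs i) (xs j) := by
    intro n v xs i j k
    simp [pairF, hp]
  have hR : ∀ w : ℕ, @Structure.RelMap arithR ℕ (modelR Q) 1 rSym ![w] ↔ w ∈ Q :=
    fun _ => Iff.rfl
  simp [Holds, psi, exR, allR, noR, inR, hpF, hR]

end PosFix

namespace PosFix

open FirstOrder FirstOrder.Language Nat.Partrec

/-! ### Sections of fixed points -/

/-- For the code `a = pr 0 e` the section `{b | pr a b ∈ Q}` of a fixed point `Q` is `{e}`, and for
`a = pr 1 e` it is a union of intersections of the sections whose codes are listed by `{e}`. -/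
theorem IsFixedPoint.mem_iff {pr : ℕ → ℕ → ℕ} (pr_inj : Function.Injective2 pr) {p : ℕ}
    (hp : ∀ i j : ℕ, rfn p (Nat.pair i j) = Part.some (pr i j)) {Q : Set ℕ}
    (hQ : IsFixedPoint (psi p) Q) :
    (∀ e b, pr (pr 0 e) b ∈ Q ↔ b = e) ∧
    ∀ e b, pr (pr 1 e) b ∈ Q ↔ ∃ t, ∀ s, ∃ w ∈ rfn e (pr t s), pr w b ∈ Q := by
  have key := fun y => (hQ y).trans (holds_psi hp y Q)
  refine ⟨fun e b => ⟨fun h => ?_, fun h => ?_⟩, fun e b => ⟨fun h => ?_, fun h => ?_⟩⟩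
  · obtain ⟨a, b', e', h1, ⟨h2, h3⟩ | ⟨h2, -⟩⟩ := (key _).1 h
    · obtain ⟨rfl, rfl⟩ := pr_inj h1
      exact h3.trans (pr_inj h2).2.symm
    · obtain ⟨rfl, rfl⟩ := pr_inj h1
      exact absurd (pr_inj h2).1 (by decide)
  · exact (key _).2 ⟨_, _, _, rfl, Or.inl ⟨rfl, h⟩⟩
  · obtain ⟨a, b', e', h1, ⟨h2, h3⟩ | ⟨h2, h3⟩⟩ := (key _).1 h
    · obtain ⟨rfl, rfl⟩ := pr_inj h1
      exact absurd (pr_inj h2).1 (by decide)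
    · obtain ⟨rfl, rfl⟩ := pr_inj h1
      obtain ⟨-, rfl⟩ := pr_inj h2
      exact h3
  · exact (key _).2 ⟨_, _, _, rfl, Or.inr ⟨rfl, h⟩⟩

theorem rfn_encode (c : Code) : rfn (Encodable.encode c) = c.eval := by
  rw [rfn, Denumerable.ofNat_encode]

theorem computable_pr {pr : ℕ → ℕ → ℕ} {p : ℕ}
    (hp : ∀ i j : ℕ, rfn p (Nat.pair i j) = Part.some (pr i j)) : Computable₂ pr := by
  have h : Partrec (rfn p) := by
    exact Code.eval_part.comp (Computable.const _) Computable.id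
  have h2 : Partrec₂ fun i j : ℕ => rfn p (Nat.pair i j) :=
    h.comp (Primrec₂.natPair.to_comp)
  exact h2.of_eq fun q => hp q.1 q.2

/-- A recursive injective pairing function has a partial recursive inverse. -/
theorem exists_partrec_unpair {pr : ℕ → ℕ → ℕ} (pr_inj : Function.Injective2 pr)
    (hpr : Computable₂ pr) :
    ∃ u : ℕ →. ℕ, Partrec u ∧ ∀ t s, u (pr t s) = Part.some (Nat.pair t s) := by
  refine ⟨fun k => Nat.rfind fun n =>
    Part.some (decide (pr n.unpair.1 n.unpair.2 = k)), ?_, fun t s => ?_⟩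
  · refine Partrec.rfind (p := fun k n => Part.some (decide (pr n.unpair.1 n.unpair.2 = k))) ?_
    have h1 : Computable fun q : ℕ × ℕ => pr q.2.unpair.1 q.2.unpair.2 :=
      hpr.comp (Computable.fst.comp (Computable.unpair.comp Computable.snd))
        (Computable.snd.comp (Computable.unpair.comp Computable.snd))
    exact (Primrec.eq (α := ℕ)).decide.to_comp.comp h1 Computable.fst
  · refine Part.eq_some_iff.2 (Nat.mem_rfind.2 ⟨by simp, fun {m} hm => ?_⟩)
    simp only [Part.mem_some_iff, decide_eq_false_iff_not, eq_comm (a := false)]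
    intro h
    obtain ⟨h1, h2⟩ := pr_inj h
    rw [← Nat.pair_unpair m, h1, h2] at hm
    exact lt_irrefl _ hm

theorem computable_comp₃ {α β γ δ σ : Type*} [Primcodable α] [Primcodable β] [Primcodable γ]
    [Primcodable δ] [Primcodable σ] {g : β → γ → δ → σ} {f₁ : α → β} {f₂ : α → γ} {f₃ : α → δ}
    (hg : Computable fun q : β × γ × δ => g q.1 q.2.1 q.2.2) (h₁ : Computable f₁)
    (h₂ : Computable f₂) (h₃ : Computable f₃) : Computable fun a => g (f₁ a) (f₂ a) (f₃ a) :=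
  hg.comp (h₁.pair (h₂.pair h₃))

/-- Definition by cases on whether a node is `0`; `g` is the continuation at the subsentence that
is selected by `idx`, with the sign switched. -/
theorem exists_computable_cases {Γ : Type*} [Primcodable Γ] {z idx : Bool → ℕ → ℕ} {ch : ℕ → ℕ → ℕ}
    {g : Γ → Bool → ℕ → ℕ} (hz : Computable₂ z) (hidx : Computable₂ idx) (hch : Computable₂ ch)
    (hg : Computable fun q : Γ × Bool × ℕ => g q.1 q.2.1 q.2.2) :
    ∃ F : Γ → Bool → ℕ → ℕ → ℕ,
      (Computable fun q : Γ × Bool × ℕ × ℕ => F q.1 q.2.1 q.2.2.1 q.2.2.2) ∧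
      (∀ c sg k, F c sg 0 k = z sg k) ∧
      ∀ c sg σ k, F c sg (σ + 1) k = g c (!sg) (ch σ (idx sg k)) := by
  have h1 : Computable fun q : Γ × Bool × ℕ × ℕ => q.2.1 := Computable.fst.comp Computable.snd
  have h2 : Computable fun q : Γ × Bool × ℕ × ℕ => q.2.2.1 :=
    Computable.fst.comp (Computable.snd.comp Computable.snd)
  have h3 : Computable fun q : Γ × Bool × ℕ × ℕ => q.2.2.2 :=
    Computable.snd.comp (Computable.snd.comp Computable.snd)
  have h4 : Computable₂ fun (q : Γ × Bool × ℕ × ℕ) (σ : ℕ) =>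
      g q.1 (!q.2.1) (ch σ (idx q.2.1 q.2.2.2)) :=
    computable_comp₃ hg (Computable.fst.comp Computable.fst)
      (Primrec.not.to_comp.comp (h1.comp Computable.fst))
      (hch.comp Computable.snd (hidx.comp (h1.comp Computable.fst) (h3.comp Computable.fst)))
  exact ⟨fun c sg σ k => Nat.rec (z sg k) (fun σ _ => g c (!sg) (ch σ (idx sg k))) σ,
    Computable.nat_casesOn h2 (hz.comp h1 h3) h4, fun _ _ _ => rfl, fun _ _ _ _ => rfl⟩

/-- Let the node `0` stand for the true sentence, and the node `σ + 1` for the sentence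
"one of the sentences `ch σ i` is false". `X true σ` and `X false σ` behave like the assertions
that `σ` is true, respectively false. The tree need not be well-founded, and `X` is only required
to obey the local rules. -/
structure IsEvaluation (ch : ℕ → ℕ → ℕ) (X : Bool → ℕ → Prop) : Prop where
  true_zero : X true 0
  false_zero : ¬ X false 0
  true_succ : ∀ σ, X true (σ + 1) ↔ ∃ i, X false (ch σ i)
  false_succ : ∀ σ, X false (σ + 1) ↔ ∀ i, X true (ch σ i)

/-- The sentences of a computable tree have codes `h true σ` (for `σ`) and `h false σ` (for its
negation) such that membership in the sections of any fixed point obeys the rules of evaluation.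
The code of a union or intersection contains an index of the function that lists the codes of
the members, so `h` is found by the recursion theorem. -/
theorem exists_sections {pr : ℕ → ℕ → ℕ} (pr_inj : Function.Injective2 pr) {p : ℕ}
    (hp : ∀ i j : ℕ, rfn p (Nat.pair i j) = Part.some (pr i j))
    {ch : ℕ → ℕ → ℕ} (hch : Computable₂ ch) :
    ∃ h : Bool → ℕ → ℕ, Computable₂ h ∧ ∀ Q, IsFixedPoint (psi p) Q → ∀ b,
      IsEvaluation ch fun sg σ => pr (h sg σ) b ∈ Q := by
  have hpr := computable_pr hp
  obtain ⟨u, hu, hu'⟩ := exists_partrec_unpair pr_inj hpr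
  -- `w sg σ` codes a signed node; the program `c` found below computes, from `w sg σ` and
  -- `pr t s`, the code of the section in row `t` and column `s` of the union of intersections.
  obtain ⟨w, hw, hw'⟩ : ∃ w : Bool → ℕ → ℕ, Computable₂ w ∧
      ∀ sg σ, ((w sg σ).unpair.1 == 1) = sg ∧ (w sg σ).unpair.2 = σ :=
    ⟨fun sg σ => Nat.pair (bif sg then 1 else 0) σ, Primrec₂.natPair.to_comp.comp
      (Computable.cond Computable.fst (Computable.const 1) (Computable.const 0))
      Computable.snd, by rintro (_ | _) σ <;> simp⟩
  obtain ⟨g, hg, hg'⟩ : ∃ g : Code → Bool → ℕ → ℕ,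
      (Computable fun q : Code × Bool × ℕ => g q.1 q.2.1 q.2.2) ∧
      ∀ c sg σ, g c sg σ = pr 1 (Encodable.encode (c.curry (w sg σ))) :=
    ⟨fun c sg σ => pr 1 (Encodable.encode (c.curry (w sg σ))),
      hpr.comp (Computable.const 1) (Computable.encode.comp (Code.primrec₂_curry.to_comp.comp
        Computable.fst (hw.comp (Computable.fst.comp Computable.snd)
          (Computable.snd.comp Computable.snd)))), fun _ _ _ => rfl⟩
  -- An asserted sentence is a union over `t`, a negated one an intersection over `s`.
  obtain ⟨idx, hidx, hidx'⟩ : ∃ idx : Bool → ℕ → ℕ, Computable₂ idx ∧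
      ∀ t s, idx true (Nat.pair t s) = t ∧ idx false (Nat.pair t s) = s :=
    ⟨fun sg k => bif sg then k.unpair.1 else k.unpair.2, Computable.cond Computable.fst
      (Computable.fst.comp (Computable.unpair.comp Computable.snd))
      (Computable.snd.comp (Computable.unpair.comp Computable.snd)), by simp⟩
  have hz : Computable₂ fun sg k => pr 0 (idx sg k) := hpr.comp (Computable.const 0) hidx
  obtain ⟨F, hF, hF0, hF1⟩ := exists_computable_cases hz hidx hch hg
  have hk : Computable fun q : Code × ℕ => q.2.unpair.1 :=
    Computable.fst.comp (Computable.unpair.comp Computable.snd)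
  have hk1 : Computable fun q : Code × ℕ => q.2.unpair.1.unpair.1 == 1 :=
    (Primrec.beq (α := ℕ)).to_comp.comp
      (Computable.fst.comp (Computable.unpair.comp hk)) (Computable.const 1)
  have hk2 : Computable fun q : Code × ℕ => q.2.unpair.1.unpair.2 :=
    Computable.snd.comp (Computable.unpair.comp hk)
  have hu2 : Partrec fun q : Code × ℕ => u q.2.unpair.2 :=
    hu.comp (Computable.snd.comp (Computable.unpair.comp Computable.snd))
  have hF2 : Computable fun q : (Code × ℕ) × ℕ =>
      F q.1.1 (q.1.2.unpair.1.unpair.1 == 1) q.1.2.unpair.1.unpair.2 q.2 :=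
    hF.comp ((Computable.fst.comp Computable.fst).pair ((hk1.comp Computable.fst).pair
      ((hk2.comp Computable.fst).pair Computable.snd)))
  have hf : Partrec₂ fun (c : Code) (k : ℕ) => (u k.unpair.2).map
      (F c (k.unpair.1.unpair.1 == 1) k.unpair.1.unpair.2) := Partrec.map hu2 hF2
  obtain ⟨c, hc⟩ := Code.fixed_point₂ hf
  have hval : ∀ sg σ t s, rfn (Encodable.encode (c.curry (w sg σ))) (pr t s) =
      Part.some (F c sg σ (Nat.pair t s)) := by
    intro sg σ t s
    rw [rfn_encode, Code.eval_curry, hc]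
    simp [hw', hu']
  refine ⟨g c, hg.comp ((Computable.const c).pair (Computable.fst.pair Computable.snd)),
    fun Q hQ b => ?_⟩
  obtain ⟨h0, h1⟩ := hQ.mem_iff pr_inj hp
  refine ⟨?_, fun h => ?_, fun σ => ?_, fun σ => ?_⟩
  · rw [hg', h1]
    exact ⟨b, fun s => ⟨pr 0 b, by simp [hval, hF0, hidx'], (h0 _ _).2 rfl⟩⟩
  · rw [hg', h1] at h
    obtain ⟨t, ht⟩ := h
    -- The section is the intersection of all singletons `{s}`, and `{b + 1}` does not contain `b`.
    obtain ⟨v, hv, hv'⟩ := ht (b + 1)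
    rw [hval, Part.mem_some_iff] at hv
    simp [hv, hF0, hidx', h0] at hv'
  · rw [hg', h1]
    simp [hval, hF1, hidx']
  · rw [hg', h1]
    simp [hval, hF1, hidx']

/-- A computable family of sections has a diagonal section: it is the union of the
intersections of `{t}` with the section of index `τ t`. -/
theorem exists_diagonal_section {pr : ℕ → ℕ → ℕ} (pr_inj : Function.Injective2 pr) {p : ℕ}
    (hp : ∀ i j : ℕ, rfn p (Nat.pair i j) = Part.some (pr i j))
    {τ : ℕ → ℕ} (hτ : Computable τ) :
    ∃ a, ∀ Q, IsFixedPoint (psi p) Q → ∀ b, pr a b ∈ Q ↔ pr (τ b) b ∈ Q := by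
  have hpr := computable_pr hp
  obtain ⟨u, hu, hu'⟩ := exists_partrec_unpair pr_inj hpr
  let F : ℕ → ℕ := fun k => Nat.casesOn k.unpair.2 (pr 0 k.unpair.1) fun _ => τ k.unpair.1
  have hF : Computable F := by
    have hk : Computable fun k : ℕ => k.unpair.1 := Computable.fst.comp Computable.unpair
    exact Computable.nat_casesOn (Computable.snd.comp Computable.unpair)
      (hpr.comp (Computable.const 0) hk) ((hτ.comp hk).comp Computable.fst)
  obtain ⟨c, hc⟩ := Code.exists_code.1
    (Partrec.nat_iff.1 (Partrec.map hu (g := fun _ k => F k)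
    (hF.comp Computable.snd)))
  have hval : ∀ t s, rfn (Encodable.encode c) (pr t s) = Part.some (F (Nat.pair t s)) := by
    intro t s
    rw [rfn_encode, hc]
    simp [hu']
  refine ⟨pr 1 (Encodable.encode c), fun Q hQ b => ?_⟩
  obtain ⟨h0, h1⟩ := hQ.mem_iff pr_inj hp
  rw [h1]
  constructor
  · rintro ⟨t, h⟩
    have h2 := h 0
    have h3 := h 1
    simp only [hval, Part.mem_some_iff, exists_eq_left, F, Nat.unpair_pair] at h2 h3
    obtain rfl : b = t := (h0 _ _).1 h2
    exact h3
  · refine fun h => ⟨b, fun s => ⟨F (Nat.pair b s), by simp [hval], ?_⟩⟩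
    cases s with
    | zero => simp [F, h0]
    | succ s => simpa [F] using h

end PosFix

namespace PosFix

open FirstOrder FirstOrder.Language

/-! ### Satisfaction over transitive sets -/

/- Every natural number codes a formula of set theory with de Bruijn indices, built from the
formulas `¬ (xᵢ ∈ xⱼ)` by the operations `¬ (φ ∧ χ)` and `∃ x₀, ¬ φ`. These connectives match the
shape "one of the sentences `ch σ i` is false" of the infinitary sentences above. -/

/-- Adding a first entry to an infinite sequence. -/
def cons {α : Type*} (a : α) (e : ℕ → α) : ℕ → α
  | 0 => a
  | k + 1 => e k

@[simp] theorem cons_zero {α : Type*} (a : α) (e : ℕ → α) : cons a e 0 = a := rfl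

@[simp] theorem cons_succ {α : Type*} (a : α) (e : ℕ → α) (k : ℕ) : cons a e (k + 1) = e k := rfl

/-- The code of `¬ (xᵢ ∈ xⱼ)`. -/
def nmemC (i j : ℕ) : ℕ := 3 * Nat.pair i j

/-- The code of `¬ (φ ∧ χ)`. -/
def nandC (φ χ : ℕ) : ℕ := 3 * Nat.pair φ χ + 1

/-- The code of `∃ x₀, ¬ φ`. -/
def exNotC (φ : ℕ) : ℕ := 3 * φ + 2

theorem left_lt_nandC (φ χ : ℕ) : φ < nandC φ χ := by
  have := Nat.left_le_pair φ χ
  unfold nandC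
  omega

theorem right_lt_nandC (φ χ : ℕ) : χ < nandC φ χ := by
  have := Nat.right_le_pair φ χ
  unfold nandC
  omega

theorem lt_exNotC (φ : ℕ) : φ < exNotC φ := by
  unfold exNotC
  omega

theorem exists_code_eq (φ : ℕ) :
    (∃ i j, φ = nmemC i j) ∨ (∃ χ θ, φ = nandC χ θ) ∨ ∃ χ, φ = exNotC χ := by
  have h : φ = 3 * (φ / 3) + φ % 3 := by omega
  have h3 : φ % 3 < 3 := Nat.mod_lt _ (by norm_num)
  rw [h]
  interval_cases φ % 3
  · exact Or.inl ⟨(φ / 3).unpair.1, (φ / 3).unpair.2, by simp [nmemC]⟩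
  · exact Or.inr (Or.inl ⟨(φ / 3).unpair.1, (φ / 3).unpair.2, by simp [nandC]⟩)
  · exact Or.inr (Or.inr ⟨φ / 3, rfl⟩)

/-- Induction on formulas, every natural number being the code of a formula. -/
theorem code_induction {P : ℕ → Prop} (nmem : ∀ i j, P (nmemC i j))
    (nand : ∀ φ χ, P φ → P χ → P (nandC φ χ)) (exNot : ∀ φ, P φ → P (exNotC φ)) (φ : ℕ) : P φ := by
  induction φ using Nat.strong_induction_on with
  | _ φ ih =>
    rcases exists_code_eq φ with ⟨i, j, rfl⟩ | ⟨χ, θ, rfl⟩ | ⟨χ, rfl⟩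
    · exact nmem i j
    · exact nand _ _ (ih _ (left_lt_nandC _ _)) (ih _ (right_lt_nandC _ _))
    · exact exNot _ (ih _ (lt_exNotC _))

/-- The formula coded by `φ` holds in `(A, ∈)` under the assignment `e`. The values of `e` need not
belong to `A`: an atomic formula `¬ (xᵢ ∈ xⱼ)` is false if one of its variables has a value outside
`A`, while the quantifiers always range over `A`. -/
def Sat (A : ZFSet.{0}) (φ : ℕ) (e : ℕ → ZFSet.{0}) : Prop :=
  if h0 : φ % 3 = 0 then
    e (φ / 3).unpair.1 ∈ A ∧ e (φ / 3).unpair.2 ∈ A ∧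
      e (φ / 3).unpair.1 ∉ e (φ / 3).unpair.2
  else if h1 : φ % 3 = 1 then
    ¬ (Sat A (φ / 3).unpair.1 e ∧ Sat A (φ / 3).unpair.2 e)
  else ∃ a ∈ A, ¬ Sat A (φ / 3) (cons a e)
termination_by φ
decreasing_by
  · have := Nat.unpair_left_le (φ / 3); omega
  · have := Nat.unpair_right_le (φ / 3); omega
  · omega

section Sat

variable {A : ZFSet.{0}} {e : ℕ → ZFSet.{0}}

@[simp] theorem sat_nmemC {i j : ℕ} : Sat A (nmemC i j) e ↔ e i ∈ A ∧ e j ∈ A ∧ e i ∉ e j := by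
  rw [Sat]
  simp [nmemC]

@[simp] theorem sat_nandC {φ χ : ℕ} : Sat A (nandC φ χ) e ↔ ¬ (Sat A φ e ∧ Sat A χ e) := by
  rw [Sat]
  have h1 : nandC φ χ % 3 = 1 := by unfold nandC; omega
  have h2 : nandC φ χ / 3 = Nat.pair φ χ := by unfold nandC; omega
  simp [h1, h2]

@[simp] theorem sat_exNotC {φ : ℕ} : Sat A (exNotC φ) e ↔ ∃ a ∈ A, ¬ Sat A φ (cons a e) := by
  rw [Sat]
  have h1 : exNotC φ % 3 = 2 := by unfold exNotC; omega
  have h2 : exNotC φ / 3 = φ := by unfold exNotC; omega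
  simp [h1, h2]

/-- The code of `¬ φ`. -/
def notC (φ : ℕ) : ℕ := nandC φ φ

@[simp] theorem sat_notC {φ : ℕ} : Sat A (notC φ) e ↔ ¬ Sat A φ e := by simp [notC]

/-- The code of `φ ∧ χ`. -/
def andC (φ χ : ℕ) : ℕ := notC (nandC φ χ)

@[simp] theorem sat_andC {φ χ : ℕ} : Sat A (andC φ χ) e ↔ Sat A φ e ∧ Sat A χ e := by simp [andC]

/-- The code of `φ → χ`. -/
def impC (φ χ : ℕ) : ℕ := nandC φ (notC χ)

@[simp] theorem sat_impC {φ χ : ℕ} : Sat A (impC φ χ) e ↔ (Sat A φ e → Sat A χ e) := by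
  simp [impC]

/-- The code of `∀ x₀, φ`. -/
def allC (φ : ℕ) : ℕ := notC (exNotC φ)

@[simp] theorem sat_allC {φ : ℕ} : Sat A (allC φ) e ↔ ∀ a ∈ A, Sat A φ (cons a e) := by
  simp [allC]

/-- The code of `∃ x₀, φ`. -/
def exC (φ : ℕ) : ℕ := exNotC (notC φ)

@[simp] theorem sat_exC {φ : ℕ} : Sat A (exC φ) e ↔ ∃ a ∈ A, Sat A φ (cons a e) := by
  simp [exC]

/-- The code of `xᵢ ∈ xⱼ`. -/
def memC (i j : ℕ) : ℕ := notC (nmemC i j)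

theorem sat_memC {i j : ℕ} (hi : e i ∈ A) (hj : e j ∈ A) : Sat A (memC i j) e ↔ e i ∈ e j := by
  simp [memC, hi, hj]

/-- The code of `xᵢ = xⱼ`, expressed by extensionality. -/
def eqC (i j : ℕ) : ℕ :=
  allC (andC (impC (memC 0 (i + 1)) (memC 0 (j + 1))) (impC (memC 0 (j + 1)) (memC 0 (i + 1))))

theorem sat_eqC (hA : A.IsTransitive) {i j : ℕ} (hi : e i ∈ A) (hj : e j ∈ A) :
    Sat A (eqC i j) e ↔ e i = e j := by
  rw [eqC, sat_allC]
  constructor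
  · intro h
    ext z
    constructor <;> intro hz
    · have hzA := hA.mem_trans hz hi
      have := h z hzA
      simp only [sat_andC, sat_impC] at this
      rw [sat_memC (by simpa) (by simpa), sat_memC (by simpa) (by simpa)] at this
      exact this.1 hz
    · have hzA := hA.mem_trans hz hj
      have := h z hzA
      simp only [sat_andC, sat_impC] at this
      rw [sat_memC (by simpa) (by simpa), sat_memC (by simpa) (by simpa)] at this
      exact this.2 hz
  · intro h z hz
    simp only [sat_andC, sat_impC]
    rw [sat_memC (by simpa) (by simpa), sat_memC (by simpa) (by simpa)]
    simp [h]

end Sat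

/-! ### Definable subsets -/

/-- The relation symbol of `setLang`. -/
def memSym : setLang.Relations 2 := MemRel.mem

/-- Each formula of set theory has a code, given an arrangement `ι`, `κ` of its free and bound
variables. The map `ι` need not be injective, since only the finitely many free variables of `φ`
have to get the right values. -/
theorem exists_code {A : ZFSet.{0}} (hA : A.IsTransitive) {α : Type*} [DecidableEq α] {n : ℕ}
    (φ : setLang.BoundedFormula α n) : ∀ (ι : α → ℕ) (κ : Fin n → ℕ),
    ∃ c, ∀ (v : α → {z : ZFSet.{0} // z ∈ A}) (xs : Fin n → {z : ZFSet.{0} // z ∈ A})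
      (e : ℕ → ZFSet.{0}), (∀ a ∈ φ.freeVarFinset, e (ι a) = v a) → (∀ i, e (κ i) = xs i) →
      (Sat A c e ↔ φ.Realize v xs) := by
  have hterm : ∀ {n : ℕ} (t : setLang.Term (α ⊕ Fin n)), ∃ s, t = Term.var s := by
    rintro n (s | ⟨f, -⟩)
    · exact ⟨s, rfl⟩
    · exact f.elim
  induction φ with
  | falsum =>
    intro ι κ
    refine ⟨notC (allC (eqC 0 0)), fun v xs e _ _ => ?_⟩
    simp only [sat_notC, sat_allC, BoundedFormula.Realize, iff_false, not_not]
    exact fun a ha => (sat_eqC hA (by simpa) (by simpa)).2 rfl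
  | equal t₁ t₂ =>
    intro ι κ
    obtain ⟨s₁, rfl⟩ := hterm t₁
    obtain ⟨s₂, rfl⟩ := hterm t₂
    refine ⟨eqC (Sum.elim ι κ s₁) (Sum.elim ι κ s₂), fun v xs e hv hx => ?_⟩
    have h₁ : e (Sum.elim ι κ s₁) = Sum.elim v xs s₁ := by
      rcases s₁ with a | i
      · exact hv a (by simp [BoundedFormula.freeVarFinset, Term.varFinsetLeft])
      · exact hx i
    have h₂ : e (Sum.elim ι κ s₂) = Sum.elim v xs s₂ := by
      rcases s₂ with a | i
      · exact hv a (by simp [BoundedFormula.freeVarFinset, Term.varFinsetLeft])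
      · exact hx i
    rw [sat_eqC hA (h₁ ▸ Subtype.prop _) (h₂ ▸ Subtype.prop _), h₁, h₂]
    exact Subtype.ext_iff.symm
  | rel R ts =>
    intro ι κ
    cases R
    obtain ⟨s₁, h₁⟩ := hterm (ts 0)
    obtain ⟨s₂, h₂⟩ := hterm (ts 1)
    refine ⟨memC (Sum.elim ι κ s₁) (Sum.elim ι κ s₂), fun v xs e hv hx => ?_⟩
    have h₁' : e (Sum.elim ι κ s₁) = Sum.elim v xs s₁ := by
      rcases s₁ with a | i
      · refine hv a ?_
        simp only [BoundedFormula.freeVarFinset, Finset.mem_biUnion, Finset.mem_univ, true_and]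
        exact ⟨0, by simp [h₁, Term.varFinsetLeft]⟩
      · exact hx i
    have h₂' : e (Sum.elim ι κ s₂) = Sum.elim v xs s₂ := by
      rcases s₂ with a | i
      · refine hv a ?_
        simp only [BoundedFormula.freeVarFinset, Finset.mem_biUnion, Finset.mem_univ, true_and]
        exact ⟨1, by simp [h₂, Term.varFinsetLeft]⟩
      · exact hx i
    rw [sat_memC (h₁' ▸ Subtype.prop _) (h₂' ▸ Subtype.prop _), h₁', h₂']
    change _ ↔ ((ts 0).realize (Sum.elim v xs)).1 ∈ ((ts 1).realize (Sum.elim v xs)).1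
    rw [h₁, h₂]
    rfl
  | imp φ χ ih₁ ih₂ =>
    intro ι κ
    obtain ⟨c, hc⟩ := ih₁ ι κ
    obtain ⟨d, hd⟩ := ih₂ ι κ
    refine ⟨impC c d, fun v xs e hv hx => ?_⟩
    simp only [BoundedFormula.freeVarFinset, Finset.mem_union] at hv
    rw [sat_impC, hc v xs e (fun a ha => hv a (Or.inl ha)) hx,
      hd v xs e (fun a ha => hv a (Or.inr ha)) hx]
    rfl
  | all φ ih =>
    intro ι κ
    obtain ⟨c, hc⟩ := ih (fun a => ι a + 1) (Fin.snoc (fun i => κ i + 1) 0)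
    refine ⟨allC c, fun v xs e hv hx => ?_⟩
    rw [sat_allC, BoundedFormula.realize_all, Subtype.forall]
    refine forall₂_congr fun a ha => hc v _ _ hv fun i => ?_
    cases i using Fin.lastCases with
    | last => simp
    | cast i => simp [hx]

/-- Each code is the code of a formula of set theory. The map `κ` tells which variable of that
formula corresponds to an index, with `none` for the indices whose value lies outside `A`; atomic
formulas that contain such an index are replaced by `⊥`. -/
theorem exists_boundedFormula {A : ZFSet.{0}} {α : Type*} (c : ℕ) : ∀ {n : ℕ}
    (κ : ℕ → Option (α ⊕ Fin n)),
    ∃ φ : setLang.BoundedFormula α n, ∀ (v : α → {z : ZFSet.{0} // z ∈ A})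
      (xs : Fin n → {z : ZFSet.{0} // z ∈ A}) (e : ℕ → ZFSet.{0}),
      (∀ k, κ k = none → e k ∉ A) → (∀ k s, κ k = some s → e k = Sum.elim v xs s) →
      (φ.Realize v xs ↔ Sat A c e) := by
  induction c using code_induction with
  | nmem i j =>
    intro n κ
    rcases hi : κ i with _ | s
    · refine ⟨⊥, fun v xs e hn _ => ?_⟩
      simp [hn i hi]
    rcases hj : κ j with _ | t
    · refine ⟨⊥, fun v xs e hn _ => ?_⟩
      simp [hn j hj]
    refine ⟨∼(Relations.boundedFormula₂ memSym (Term.var s) (Term.var t)),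
      fun v xs e _ hs => ?_⟩
    rw [sat_nmemC, BoundedFormula.realize_not, BoundedFormula.realize_rel₂, hs i s hi, hs j t hj]
    simp only [Subtype.prop, true_and]
    rfl
  | nand φ χ ih₁ ih₂ =>
    intro n κ
    obtain ⟨φ', h₁⟩ := ih₁ κ
    obtain ⟨χ', h₂⟩ := ih₂ κ
    refine ⟨∼(φ' ⊓ χ'), fun v xs e hn hs => ?_⟩
    rw [sat_nandC, BoundedFormula.realize_not, BoundedFormula.realize_inf, h₁ v xs e hn hs,
      h₂ v xs e hn hs]
  | exNot φ ih =>
    intro n κ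
    obtain ⟨φ', h⟩ := ih (cons (some (Sum.inr (Fin.last n)))
      fun k => (κ k).map (Sum.map id Fin.castSucc))
    refine ⟨(∼φ').ex, fun v xs e hn hs => ?_⟩
    simp only [sat_exNotC, BoundedFormula.realize_ex, BoundedFormula.realize_not, Subtype.exists]
    refine exists_congr fun a => ?_
    rw [← exists_prop]
    refine exists_congr fun ha => not_congr (h v _ _ ?_ ?_)
    · rintro (_ | k) hk
      · cases hk
      · exact hn k (Option.map_eq_none_iff.1 hk)
    · rintro (_ | k) s hk
      · obtain rfl : Sum.inr (Fin.last n) = s := Option.some_inj.1 hk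
        simp
      · obtain ⟨t, ht, rfl⟩ := Option.map_eq_some_iff.1 hk
        rw [cons_succ, hs k t ht]
        rcases t with a | i <;> simp

theorem definablePowerset_subset {A s : ZFSet.{0}} (hs : s ∈ definablePowerset A) : s ⊆ A :=
  ZFSet.mem_powerset.1 (ZFSet.mem_sep.1 hs).1

/-- The sets that are defined by codes are definable, even when some of the parameters do not
belong to `A`. -/
theorem sep_sat_mem_definablePowerset (A : ZFSet.{0}) (c : ℕ) (e : ℕ → ZFSet.{0}) :
    ZFSet.sep (fun a => Sat A c (cons a e)) A ∈ definablePowerset A := by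
  classical
  rw [definablePowerset, ZFSet.mem_sep, ZFSet.mem_powerset]
  refine ⟨ZFSet.sep_subset, ?_⟩
  rw [Set.Definable₁, Set.definable_iff_exists_formula_sum]
  obtain ⟨φ, hφ⟩ := exists_boundedFormula (A := A)
    (α := (Set.univ : Set {z : ZFSet.{0} // z ∈ A}) ⊕ Fin 1) c (n := 0)
    (cons (some (Sum.inl (Sum.inr 0))) fun k =>
      if hk : e k ∈ A then some (Sum.inl (Sum.inl ⟨⟨e k, hk⟩, trivial⟩)) else none)
  refine ⟨φ, Set.ext fun v => ?_⟩
  have h := hφ (Sum.elim Subtype.val v) default (cons (v 0).1 e) ?_ ?_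
  · refine Iff.trans ?_ h.symm
    simp
  · rintro (_ | k) hk
    · cases hk
    · intro hA
      simp only [cons_succ] at hA
      simp [hA] at hk
  · rintro (_ | k) s hk
    · obtain rfl : Sum.inl (Sum.inr 0) = s := Option.some_inj.1 hk
      rfl
    · by_cases hA : e k ∈ A
      · simp only [cons_succ, hA, dite_true, Option.some_inj] at hk
        subst hk
        rfl
      · simp [hA] at hk

/-- Each definable set is defined by a code with finitely many parameters `l`, which are the first
values of the assignment. -/
theorem exists_sat_of_mem_definablePowerset {A : ZFSet.{0}} (hA : A.IsTransitive) {s : ZFSet.{0}}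
    (hs : s ∈ definablePowerset A) :
    ∃ (l : List ZFSet.{0}) (c : ℕ), (∀ z ∈ l, z ∈ A) ∧
      ∀ e : ℕ → ZFSet.{0}, (∀ i (hi : i < l.length), e i = l[i]) →
        ∀ a ∈ A, a ∈ s ↔ Sat A c (cons a e) := by
  classical
  obtain ⟨φ, hφ⟩ := Set.definable_iff_exists_formula_sum.1 (ZFSet.mem_sep.1 hs).2
  let T : List {z : ZFSet.{0} // z ∈ A} := φ.freeVarFinset.toList.filterMap
    fun q => q.elim (fun a => some a.1) fun _ => none
  obtain ⟨c, hc⟩ := exists_code hA φ (fun q => q.elim (fun a => T.idxOf a.1 + 1) fun _ => 0)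
    Fin.elim0
  refine ⟨T.map Subtype.val, c, ?_, fun e he a ha => ?_⟩
  · simp only [List.mem_map]
    rintro z ⟨w, -, rfl⟩
    exact w.2
  · have h := Set.ext_iff.1 hφ fun _ => ⟨a, ha⟩
    simp only [Set.mem_ofPred_eq] at h
    rw [h]
    refine (hc _ _ _ ?_ fun i => i.elim0).symm
    rintro (b | i) hb
    · have hbT : b.1 ∈ T := List.mem_filterMap.2 ⟨Sum.inl b, Finset.mem_toList.2 hb, rfl⟩
      have hlt := List.idxOf_lt_length_of_mem hbT
      have := he (T.idxOf b.1) (by simpa using hlt)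
      simp [this]
    · simp

/-! ### The constructible hierarchy -/

theorem subset_definablePowerset {A : ZFSet.{0}} (hA : A.IsTransitive) :
    A ⊆ definablePowerset A := by
  intro s hs
  convert sep_sat_mem_definablePowerset A (memC 0 1) fun _ => s
  ext a
  rw [ZFSet.mem_sep]
  constructor
  · intro ha
    have haA := hA.mem_trans ha hs
    exact ⟨haA, (sat_memC (by simpa) (by simpa)).2 ha⟩
  · rintro ⟨ha, h⟩
    exact (sat_memC (by simpa) (by simpa)).1 h

theorem constructible_add_one (α : Ordinal.{0}) :
    constructible (α + 1) = definablePowerset (constructible α) :=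
  Ordinal.limitRecOn_add_one ..

theorem mem_constructible_limit {l : Ordinal.{0}} (hl : Order.IsSuccLimit l) {z : ZFSet.{0}} :
    z ∈ constructible l ↔ ∃ β < l, z ∈ constructible β := by
  rw [constructible, Ordinal.limitRecOn_limit _ _ _ _ hl, ZFSet.mem_iUnion]
  simp [constructible]

/-- Transitivity is proved together with the uniform description of `L_α` as the union of the
definable power sets of the earlier levels, which makes the case distinction on `α` disappear. -/
theorem isTransitive_and_mem_constructible (α : Ordinal.{0}) : (constructible α).IsTransitive ∧
    ∀ z, z ∈ constructible α ↔ ∃ β < α, z ∈ definablePowerset (constructible β) := by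
  induction α using Ordinal.limitRecOn with
  | zero =>
    have h0 : constructible 0 = ∅ := Ordinal.limitRecOn_zero ..
    rw [h0]
    exact ⟨ZFSet.isTransitive_empty, by simp⟩
  | add_one α ih =>
    obtain ⟨ht, h⟩ := ih
    rw [constructible_add_one]
    refine ⟨fun s hs z hz => subset_definablePowerset ht (definablePowerset_subset hs hz),
      fun z => ⟨fun hz => ⟨α, Order.lt_add_one_iff.2 le_rfl, hz⟩, ?_⟩⟩
    rintro ⟨β, hβ, hz⟩
    rcases (Order.lt_add_one_iff.1 hβ).lt_or_eq with hlt | rfl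
    · exact subset_definablePowerset ht ((h z).2 ⟨β, hlt, hz⟩)
    · exact hz
  | limit l hl ih =>
    refine ⟨fun s hs z hz => ?_, fun z => ?_⟩
    · obtain ⟨β, hβ, hs⟩ := (mem_constructible_limit hl).1 hs
      exact (mem_constructible_limit hl).2 ⟨β, hβ, (ih β hβ).1 s hs hz⟩
    · rw [mem_constructible_limit hl]
      constructor
      · rintro ⟨β, hβ, hz⟩
        exact ⟨β, hβ, subset_definablePowerset (ih β hβ).1 hz⟩
      · rintro ⟨β, hβ, hz⟩
        exact ⟨β + 1, hl.add_one_lt hβ, by rwa [constructible_add_one]⟩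

theorem isTransitive_constructible (α : Ordinal.{0}) : (constructible α).IsTransitive :=
  (isTransitive_and_mem_constructible α).1

theorem mem_constructible {α : Ordinal.{0}} {z : ZFSet.{0}} :
    z ∈ constructible α ↔ ∃ β < α, z ∈ definablePowerset (constructible β) :=
  (isTransitive_and_mem_constructible α).2 z

end PosFix

namespace PosFix

/-! ### Names -/

/-- The `i`-th entry of the infinite sequence coded by `v`: the sequence with first entry `n`
followed by the sequence coded by `w` is coded by `Nat.pair n w`. -/
def entry (i v : ℕ) : ℕ := ((fun w => w.unpair.2)^[i] v).unpair.1

@[simp] theorem entry_zero (n v : ℕ) : entry 0 (Nat.pair n v) = n := by simp [entry]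

@[simp] theorem entry_succ (i n v : ℕ) : entry (i + 1) (Nat.pair n v) = entry i v := by
  simp [entry]

/-- The level of the name `n = Nat.pair b (Nat.pair φ q)` is `b`. -/
def lev (n : ℕ) : ℕ := n.unpair.1

/-- The formula of the name `n = Nat.pair b (Nat.pair φ q)` is `φ`. -/
def form (n : ℕ) : ℕ := n.unpair.2.unpair.1

/-- The sequence of parameters of the name `n = Nat.pair b (Nat.pair φ q)` is coded by `q`. -/
def par (n : ℕ) : ℕ := n.unpair.2.unpair.2

/-- A binary relation on `ℕ` together with a rank function for which the predecessors of `a` have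
exactly the ranks below the rank of `a`. -/
structure RankedRel where
  /-- The relation. -/
  R : ℕ → ℕ → Bool
  /-- The rank of a number. -/
  rk : ℕ → Ordinal.{0}
  /-- The rank of a predecessor is smaller. -/
  rk_lt : ∀ {b a}, R b a = true → rk b < rk a
  /-- Every smaller ordinal is the rank of a predecessor. -/
  exists_of_lt : ∀ {γ a}, γ < rk a → ∃ b, R b a = true ∧ rk b = γ

namespace RankedRel

variable (W : RankedRel)

/-- The level of the constructible hierarchy that belongs to the number `a`. -/
noncomputable def L (a : ℕ) : ZFSet.{0} := constructible (W.rk a)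

/-- The set denoted by the name `n = Nat.pair b (Nat.pair φ q)`: the subset of `W.L b` defined by
`φ` with the parameters denoted by the entries of `q`. Every natural number is a name; an entry
whose level is not below `b` is replaced by `W.L b`, which is not an element of `W.L b`. -/
noncomputable def den (n : ℕ) : ZFSet.{0} :=
  ZFSet.sep (fun x => Sat (W.L (lev n)) (form n) (cons x fun i =>
    if _h : W.R (lev (entry i (par n))) (lev n) = true then den (entry i (par n))
    else W.L (lev n))) (W.L (lev n))
termination_by W.rk (lev n)
decreasing_by exact W.rk_lt _h

/-- The assignment over `W.L a` given by the sequence of names coded by `v`. A name whose level is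
not below `a` is replaced by `W.L a`, which is not an element of `W.L a`. -/
noncomputable def env (a v : ℕ) (i : ℕ) : ZFSet.{0} :=
  if W.R (lev (entry i v)) a = true then W.den (entry i v) else W.L a

theorem den_eq (n : ℕ) : W.den n =
    ZFSet.sep (fun x => Sat (W.L (lev n)) (form n) (cons x (W.env (lev n) (par n))))
      (W.L (lev n)) := by
  rw [den]
  rfl

theorem env_pair {a n : ℕ} (h : W.R (lev n) a = true) (v : ℕ) :
    W.env a (Nat.pair n v) = cons (W.den n) (W.env a v) := by
  funext i
  cases i with
  | zero => simp [env, h]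
  | succ i => simp [env]

theorem isTransitive_L (a : ℕ) : (W.L a).IsTransitive := isTransitive_constructible _

theorem L_notMem_L (a : ℕ) : W.L a ∉ W.L a := ZFSet.mem_irrefl _

theorem den_mem_L {n a : ℕ} (h : W.R (lev n) a = true) : W.den n ∈ W.L a := by
  rw [den_eq]
  exact mem_constructible.2 ⟨_, W.rk_lt h, sep_sat_mem_definablePowerset _ _ _⟩

theorem env_mem_L_iff {a v i : ℕ} : W.env a v i ∈ W.L a ↔ W.R (lev (entry i v)) a = true := by
  unfold env
  split_ifs with h
  · simp [h, W.den_mem_L h]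
  · simp [h, W.L_notMem_L]

theorem den_mem_den_iff {n t : ℕ} (h : W.R (lev n) (lev t) = true) :
    W.den n ∈ W.den t ↔
      Sat (W.L (lev t)) (form t) (W.env (lev t) (Nat.pair n (par t))) := by
  rw [W.den_eq t, ZFSet.mem_sep, W.env_pair h]
  simp [W.den_mem_L h]

/-- Finite sequences of elements of `W.L a` are given by codes if each element has a name. The
hypothesis is always true, but it is needed only at smaller ranks in the proof of this. -/
theorem exists_env_eq {a : ℕ} (h : ∀ z ∈ W.L a, ∃ n, W.R (lev n) a = true ∧ W.den n = z) :
    ∀ l : List ZFSet.{0}, (∀ z ∈ l, z ∈ W.L a) →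
      ∃ v, ∀ i (hi : i < l.length), W.env a v i = l[i]
  | [], _ => ⟨0, by simp⟩
  | z :: l, hl => by
    obtain ⟨v, hv⟩ := exists_env_eq h l fun z hz => hl z (List.mem_cons_of_mem _ hz)
    obtain ⟨n, hn, rfl⟩ := h z (hl z List.mem_cons_self)
    refine ⟨Nat.pair n v, ?_⟩
    rw [W.env_pair hn]
    rintro (_ | i) hi
    · rfl
    · exact hv i (by simpa using hi)

theorem exists_den_eq (γ : Ordinal.{0}) :
    ∀ a, W.rk a = γ → ∀ z ∈ W.L a, ∃ n, W.R (lev n) a = true ∧ W.den n = z := by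
  induction γ using WellFoundedLT.induction with
  | _ γ ih =>
    rintro a rfl z hz
    obtain ⟨β, hβ, hz⟩ := mem_constructible.1 hz
    obtain ⟨b, hb, rfl⟩ := W.exists_of_lt hβ
    obtain ⟨l, c, hl, hc⟩ := exists_sat_of_mem_definablePowerset (W.isTransitive_L b) hz
    obtain ⟨v, hv⟩ := W.exists_env_eq (ih _ hβ b rfl) l hl
    refine ⟨Nat.pair b (Nat.pair c v), by simpa [lev] using hb, ?_⟩
    ext x
    rw [den_eq, ZFSet.mem_sep]
    simp only [lev, form, par, Nat.unpair_pair]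
    constructor
    · rintro ⟨hx, h⟩
      exact (hc _ hv x hx).2 h
    · intro h
      have hx := definablePowerset_subset hz h
      exact ⟨hx, (hc _ hv x hx).1 h⟩

theorem mem_L_iff {a : ℕ} {z : ZFSet.{0}} :
    z ∈ W.L a ↔ ∃ n, W.R (lev n) a = true ∧ W.den n = z := by
  refine ⟨W.exists_den_eq _ a rfl z, ?_⟩
  rintro ⟨n, hn, rfl⟩
  exact W.den_mem_L hn

theorem den_subset (n : ℕ) : W.den n ⊆ W.L (lev n) := by
  rw [den_eq]
  exact ZFSet.sep_subset

theorem mem_den_iff {s : ℕ} {z : ZFSet.{0}} : z ∈ W.den s ↔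
    ∃ n, W.R (lev n) (lev s) = true ∧ W.den n ∈ W.den s ∧ W.den n = z := by
  constructor
  · intro h
    obtain ⟨n, hn, rfl⟩ := W.mem_L_iff.1 (W.den_subset s h)
    exact ⟨n, hn, h, rfl⟩
  · rintro ⟨n, -, h, rfl⟩
    exact h

theorem den_ne_den_iff {s t : ℕ} : W.den s ≠ W.den t ↔
    (∃ u, W.R (lev u) (lev s) = true ∧ W.den u ∈ W.den s ∧ W.den u ∉ W.den t) ∨
      ∃ u, W.R (lev u) (lev t) = true ∧ W.den u ∈ W.den t ∧ W.den u ∉ W.den s := by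
  constructor
  · intro h
    by_contra! hne
    refine h (ZFSet.ext fun z => ⟨fun hz => ?_, fun hz => ?_⟩)
    · obtain ⟨n, hn, hn', rfl⟩ := W.mem_den_iff.1 hz
      exact hne.1 n hn hn'
    · obtain ⟨n, hn, hn', rfl⟩ := W.mem_den_iff.1 hz
      exact hne.2 n hn hn'
  · rintro (⟨u, -, h₁, h₂⟩ | ⟨u, -, h₁, h₂⟩) h
    · exact h₂ (h ▸ h₁)
    · exact h₂ (h ▸ h₁)

end RankedRel

/-! ### Truth in the constructible hierarchy as an infinitary sentence -/

/-- The sentence `¬ (σ ∧ τ)`. -/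
def nandN (σ τ : ℕ) : ℕ := Nat.pair 0 (Nat.pair σ τ) + 1

/-- The sentence saying that the formula `φ` holds in the level with number `a` at the sequence
of names coded by `v`. -/
def satN (a φ v : ℕ) : ℕ := Nat.pair 1 (Nat.pair a (Nat.pair φ v)) + 1

/-- The sentence saying that the set with name `s` is an element of the set with name `t`. -/
def memN (s t : ℕ) : ℕ := Nat.pair 2 (Nat.pair s t) + 1

/-- The sentence saying that the sets with the names `s` and `t` are different. -/
def neqN (s t : ℕ) : ℕ := Nat.pair 3 (Nat.pair s t) + 1

/-- The sentence `¬ σ`. -/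
def notN (σ : ℕ) : ℕ := nandN σ σ

/-- The sentence saying that the defining formula of the name `t` holds at the name `n`. -/
def satAtN (t n : ℕ) : ℕ := satN (lev t) (form t) (Nat.pair n (par t))

section Children

variable (R : ℕ → ℕ → Bool)

/-- The immediate subsentences of `satN a φ v`, where `d = Nat.pair a (Nat.pair φ v)`. -/
def childSat (d i : ℕ) : ℕ :=
  bif d.unpair.2.unpair.1 % 3 == 0 then
    bif R (lev (entry (d.unpair.2.unpair.1 / 3).unpair.1 d.unpair.2.unpair.2)) d.unpair.1 &&
        R (lev (entry (d.unpair.2.unpair.1 / 3).unpair.2 d.unpair.2.unpair.2)) d.unpair.1 then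
      memN (entry (d.unpair.2.unpair.1 / 3).unpair.1 d.unpair.2.unpair.2)
        (entry (d.unpair.2.unpair.1 / 3).unpair.2 d.unpair.2.unpair.2)
    else 0
  else bif d.unpair.2.unpair.1 % 3 == 1 then
    bif i == 0 then satN d.unpair.1 (d.unpair.2.unpair.1 / 3).unpair.1 d.unpair.2.unpair.2
    else satN d.unpair.1 (d.unpair.2.unpair.1 / 3).unpair.2 d.unpair.2.unpair.2
  else bif R (lev i) d.unpair.1 then
    satN d.unpair.1 (d.unpair.2.unpair.1 / 3) (Nat.pair i d.unpair.2.unpair.2)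
  else 0

/-- The immediate subsentences of `memN s t`. This sentence says that there is a name `i` below
the level of `t` that denotes the same set as `s` and at which the defining formula of `t`
holds. -/
def childMem (s t i : ℕ) : ℕ :=
  bif R (lev i) (lev t) then nandN (notN (neqN s i)) (satAtN t i) else 0

/-- The sentence saying that the name `u`, if it is below the level of `s`, does not denote an
element of the set named `s` that lies outside the set named `t`. -/
def inclN (s t u : ℕ) : ℕ :=
  bif R (lev u) (lev s) then nandN (satAtN s u) (notN (memN u t)) else 0

/-- The immediate subsentences of `neqN s t`. This sentence says that some set with a name below
the level of `s` or `t` is an element of one of the two sets only. The number `i` codes the name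
and the side. -/
def childNeq (s t i : ℕ) : ℕ :=
  bif i.unpair.1 == 0 then inclN R s t i.unpair.2 else inclN R t s i.unpair.2

/-- The immediate subsentences of the sentence `σ + 1`. -/
def child (σ i : ℕ) : ℕ :=
  bif σ.unpair.1 == 0 then bif i == 0 then σ.unpair.2.unpair.1 else σ.unpair.2.unpair.2
  else bif σ.unpair.1 == 1 then childSat R σ.unpair.2 i
  else bif σ.unpair.1 == 2 then childMem R σ.unpair.2.unpair.1 σ.unpair.2.unpair.2 i
  else childNeq R σ.unpair.2.unpair.1 σ.unpair.2.unpair.2 i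

end Children

/-- The evaluation `X` gives the sentence `σ` the truth value of `P`. -/
def Decides (X : Bool → ℕ → Prop) (σ : ℕ) (P : Prop) : Prop :=
  (X true σ ↔ P) ∧ (X false σ ↔ ¬ P)

theorem Decides.congr {X : Bool → ℕ → Prop} {σ : ℕ} {P P' : Prop} (h : Decides X σ P)
    (hP : P ↔ P') : Decides X σ P' := by rwa [← hP]

namespace IsEvaluation

variable {X : Bool → ℕ → Prop}

theorem decides_zero {ch : ℕ → ℕ → ℕ} (hX : IsEvaluation ch X) : Decides X 0 True :=
  ⟨iff_true_intro hX.true_zero, by simpa using hX.false_zero⟩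

theorem decides_succ {ch : ℕ → ℕ → ℕ} (hX : IsEvaluation ch X) {σ : ℕ} {P : ℕ → Prop}
    (h : ∀ i, Decides X (ch σ i) (P i)) : Decides X (σ + 1) (∃ i, ¬ P i) := by
  constructor
  · rw [hX.true_succ]
    exact exists_congr fun i => (h i).2
  · rw [hX.false_succ, not_exists]
    exact forall_congr' fun i => (h i).1.trans not_not.symm

variable {W : RankedRel} (hX : IsEvaluation (child W.R) X)

include hX

theorem decides_nandN {σ τ : ℕ} {P P' : Prop} (h : Decides X σ P) (h' : Decides X τ P') :
    Decides X (nandN σ τ) (¬ (P ∧ P')) := by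
  refine (hX.decides_succ (P := fun i => if i = 0 then P else P') fun i => ?_).congr ?_
  · cases i <;> simpa [child]
  · rw [not_and_or]
    constructor
    · rintro ⟨_ | i, hi⟩
      · exact Or.inl hi
      · exact Or.inr hi
    · rintro (hi | hi)
      · exact ⟨0, hi⟩
      · exact ⟨1, hi⟩

theorem decides_notN {σ : ℕ} {P : Prop} (h : Decides X σ P) : Decides X (notN σ) (¬ P) :=
  (hX.decides_nandN h h).congr (by rw [and_self])

/-- A guarded sentence is decided, being replaced by `0` where the guard fails. -/
theorem decides_guard {g : Bool} {σ : ℕ} {P : Prop} (h : g = true → Decides X σ P) :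
    Decides X (bif g then σ else 0) (g = true → P) := by
  cases g
  · simpa using hX.decides_zero
  · simpa using h rfl

theorem decides_memN {s t : ℕ}
    (ht : ∀ i, W.R (lev i) (lev t) = true → Decides X (satAtN t i) (W.den i ∈ W.den t))
    (hne : ∀ i, W.R (lev i) (lev t) = true → Decides X (neqN s i) (W.den s ≠ W.den i)) :
    Decides X (memN s t) (W.den s ∈ W.den t) := by
  refine (hX.decides_succ (P := fun i => W.R (lev i) (lev t) = true →
    ¬ (¬ W.den s ≠ W.den i ∧ W.den i ∈ W.den t)) fun i => ?_).congr ?_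
  · simp only [child, Nat.unpair_pair]
    exact hX.decides_guard fun h => hX.decides_nandN (hX.decides_notN (hne i h)) (ht i h)
  · rw [W.mem_den_iff]
    refine exists_congr fun i => ?_
    rw [Classical.not_imp, not_not, not_not, and_comm (a := W.den i ∈ W.den t),
      eq_comm (a := W.den s)]

theorem decides_inclN {s t u : ℕ}
    (hs : W.R (lev u) (lev s) = true → Decides X (satAtN s u) (W.den u ∈ W.den s))
    (hm : W.R (lev u) (lev s) = true → Decides X (memN u t) (W.den u ∈ W.den t)) :
    Decides X (inclN W.R s t u)
      (W.R (lev u) (lev s) = true → ¬ (W.den u ∈ W.den s ∧ W.den u ∉ W.den t)) :=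
  hX.decides_guard fun h => hX.decides_nandN (hs h) (hX.decides_notN (hm h))

theorem decides_neqN {s t : ℕ}
    (hs : ∀ i, W.R (lev i) (lev s) = true → Decides X (satAtN s i) (W.den i ∈ W.den s))
    (ht : ∀ i, W.R (lev i) (lev t) = true → Decides X (satAtN t i) (W.den i ∈ W.den t))
    (hst : ∀ i, W.R (lev i) (lev s) = true → Decides X (memN i t) (W.den i ∈ W.den t))
    (hts : ∀ i, W.R (lev i) (lev t) = true → Decides X (memN i s) (W.den i ∈ W.den s)) :
    Decides X (neqN s t) (W.den s ≠ W.den t) := by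
  refine (hX.decides_succ (P := fun i => if i.unpair.1 = 0 then
    (W.R (lev i.unpair.2) (lev s) = true →
      ¬ (W.den i.unpair.2 ∈ W.den s ∧ W.den i.unpair.2 ∉ W.den t)) else
    (W.R (lev i.unpair.2) (lev t) = true →
      ¬ (W.den i.unpair.2 ∈ W.den t ∧ W.den i.unpair.2 ∉ W.den s))) fun i => ?_).congr ?_
  · simp only [child, childNeq, Nat.unpair_pair]
    by_cases h : i.unpair.1 = 0
    · simpa [h] using hX.decides_inclN (hs i.unpair.2) (hst i.unpair.2)
    · have hb : (i.unpair.1 == 0) = false := by simpa using h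
      simpa [h, hb] using hX.decides_inclN (ht i.unpair.2) (hts i.unpair.2)
  · rw [W.den_ne_den_iff]
    constructor
    · rintro ⟨i, hi⟩
      split_ifs at hi
      · exact Or.inl ⟨i.unpair.2, by simpa [Classical.not_imp] using hi⟩
      · exact Or.inr ⟨i.unpair.2, by simpa [Classical.not_imp] using hi⟩
    · rintro (⟨u, hu⟩ | ⟨u, hu⟩)
      · exact ⟨Nat.pair 0 u, by simpa [Classical.not_imp] using hu⟩
      · exact ⟨Nat.pair 1 u, by simpa [Classical.not_imp] using hu⟩

/-- Membership and equality of names of rank below `γ` are decided, once satisfaction is decided at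
all ranks below `γ`. The four assertions are symmetric in `s` and `t`, so that a double induction
on the two ranks suffices although `memN` and `neqN` call each other with exchanged arguments. -/
theorem decides_mem_neq {γ : Ordinal.{0}}
    (h : ∀ t, W.rk (lev t) < γ → ∀ i, W.R (lev i) (lev t) = true →
      Decides X (satAtN t i) (W.den i ∈ W.den t)) :
    ∀ (β δ : Ordinal.{0}) (s t : ℕ), W.rk (lev s) = β → W.rk (lev t) = δ → β < γ → δ < γ →
      Decides X (memN s t) (W.den s ∈ W.den t) ∧ Decides X (memN t s) (W.den t ∈ W.den s) ∧
      Decides X (neqN s t) (W.den s ≠ W.den t) ∧ Decides X (neqN t s) (W.den t ≠ W.den s) := by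
  intro β
  induction β using WellFoundedLT.induction with
  | _ β ihβ =>
    intro δ
    induction δ using WellFoundedLT.induction with
    | _ δ ihδ =>
      rintro s t rfl rfl hs ht
      have hS := fun u (hu : W.R (lev u) (lev s) = true) =>
        ihβ _ (W.rk_lt hu) _ u t rfl rfl ((W.rk_lt hu).trans hs) ht
      have hT := fun u (hu : W.R (lev u) (lev t) = true) =>
        ihδ _ (W.rk_lt hu) s u rfl rfl hs ((W.rk_lt hu).trans ht)
      have h₁ := h s hs
      have h₂ := h t ht
      exact ⟨hX.decides_memN h₂ fun i hi => (hT i hi).2.2.1,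
        hX.decides_memN h₁ fun i hi => (hS i hi).2.2.2,
        hX.decides_neqN h₁ h₂ (fun i hi => (hS i hi).1) fun i hi => (hT i hi).2.1,
        hX.decides_neqN h₂ h₁ (fun i hi => (hT i hi).2.1) fun i hi => (hS i hi).1⟩

/-- The sentence `satN a φ v` has the truth value that its meaning suggests. -/
theorem decides_satN (a : ℕ) : ∀ φ v, Decides X (satN a φ v) (Sat (W.L a) φ (W.env a v)) := by
  obtain ⟨γ, hγ⟩ : ∃ γ, W.rk a = γ := ⟨_, rfl⟩
  induction γ using WellFoundedLT.induction generalizing a with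
  | _ γ ih =>
    have hmem : ∀ s t, W.R (lev s) a = true → W.R (lev t) a = true →
        Decides X (memN s t) (W.den s ∈ W.den t) := by
      intro s t hs ht
      refine (hX.decides_mem_neq (γ := γ) (fun t ht i hi => ?_) _ _ s t rfl rfl
        (hγ ▸ W.rk_lt hs) (hγ ▸ W.rk_lt ht)).1
      exact (ih _ ht _ rfl _ _).congr (W.den_mem_den_iff hi).symm
    intro φ
    induction φ using code_induction with
    | nmem i j =>
      intro v
      refine (hX.decides_succ (P := fun _ => (W.R (lev (entry i v)) a &&
        W.R (lev (entry j v)) a) = true → W.den (entry i v) ∈ W.den (entry j v))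
        fun _ => ?_).congr ?_
      · have h := hX.decides_guard (g := W.R (lev (entry i v)) a && W.R (lev (entry j v)) a)
          (σ := memN (entry i v) (entry j v)) (P := W.den (entry i v) ∈ W.den (entry j v))
          fun h => hmem _ _ (Bool.and_eq_true _ _ ▸ h).1 (Bool.and_eq_true _ _ ▸ h).2
        simpa [child, childSat, nmemC] using h
      · rw [sat_nmemC, W.env_mem_L_iff, W.env_mem_L_iff]
        simp only [exists_const, Classical.not_imp, Bool.and_eq_true, and_assoc]
        refine and_congr_right fun hi => and_congr_right fun hj => ?_
        simp [RankedRel.env, hi, hj]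
    | nand φ χ ih₁ ih₂ =>
      intro v
      have h1 : nandC φ χ % 3 = 1 := by unfold nandC; omega
      have h2 : nandC φ χ / 3 = Nat.pair φ χ := by unfold nandC; omega
      refine (hX.decides_succ (P := fun i => if i = 0 then Sat (W.L a) φ (W.env a v) else
        Sat (W.L a) χ (W.env a v)) fun i => ?_).congr ?_
      · cases i
        · simpa [child, childSat, h1, h2] using ih₁ v
        · simpa [child, childSat, h1, h2] using ih₂ v
      · rw [sat_nandC, not_and_or]
        constructor
        · rintro ⟨_ | i, hi⟩
          · exact Or.inl hi
          · exact Or.inr hi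
        · rintro (hi | hi)
          · exact ⟨0, hi⟩
          · exact ⟨1, hi⟩
    | exNot φ ihφ =>
      intro v
      have h1 : exNotC φ % 3 = 2 := by unfold exNotC; omega
      have h2 : exNotC φ / 3 = φ := by unfold exNotC; omega
      refine (hX.decides_succ (P := fun i => W.R (lev i) a = true →
        Sat (W.L a) φ (W.env a (Nat.pair i v))) fun i => ?_).congr ?_
      · simpa [child, childSat, h1, h2] using
          hX.decides_guard (g := W.R (lev i) a) fun _ => ihφ (Nat.pair i v)
      · rw [sat_exNotC]
        constructor
        · rintro ⟨i, hi⟩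
          rw [Classical.not_imp] at hi
          refine ⟨W.den i, W.den_mem_L hi.1, ?_⟩
          rw [← W.env_pair hi.1]
          exact hi.2
        · rintro ⟨z, hz, h⟩
          obtain ⟨i, hi, rfl⟩ := W.mem_L_iff.1 hz
          refine ⟨i, ?_⟩
          rw [Classical.not_imp, W.env_pair hi]
          exact ⟨hi, h⟩

end IsEvaluation
end PosFix

namespace PosFix

/-! ### Computability of the tree of sentences -/

section Computability

variable {α : Type*} [Primcodable α] {f g h : α → ℕ}

theorem computable_left (hf : Computable f) : Computable fun a => (f a).unpair.1 :=
  Computable.fst.comp (Computable.unpair.comp hf)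

theorem computable_right (hf : Computable f) : Computable fun a => (f a).unpair.2 :=
  Computable.snd.comp (Computable.unpair.comp hf)

theorem computable_natPair (hf : Computable f) (hg : Computable g) :
    Computable fun a => Nat.pair (f a) (g a) :=
  Primrec₂.natPair.to_comp.comp hf hg

theorem computable_beq (hf : Computable f) (k : ℕ) : Computable fun a => f a == k :=
  (Primrec.beq (α := ℕ)).to_comp.comp hf (Computable.const k)

theorem computable_div (hf : Computable f) (k : ℕ) : Computable fun a => f a / k :=
  Primrec.nat_div.to_comp.comp hf (Computable.const k)

theorem computable_mod (hf : Computable f) (k : ℕ) : Computable fun a => f a % k :=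
  Primrec.nat_mod.to_comp.comp hf (Computable.const k)

theorem computable_entry (hf : Computable f) (hg : Computable g) :
    Computable fun a => entry (f a) (g a) := by
  have h : Primrec₂ entry := by
    refine Primrec.fst.comp (Primrec.unpair.comp
      (Primrec.nat_iterate Primrec.fst Primrec.snd ?_))
    exact Primrec.snd.comp (Primrec.unpair.comp Primrec.snd)
  exact h.to_comp.comp hf hg

theorem computable_lev (hf : Computable f) : Computable fun a => lev (f a) :=
  computable_left hf

theorem computable_nandN (hf : Computable f) (hg : Computable g) :
    Computable fun a => nandN (f a) (g a) :=
  Computable.succ.comp (computable_natPair (Computable.const 0) (computable_natPair hf hg))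

theorem computable_satN (hf : Computable f) (hg : Computable g) (hh : Computable h) :
    Computable fun a => satN (f a) (g a) (h a) :=
  Computable.succ.comp (computable_natPair (Computable.const 1)
    (computable_natPair hf (computable_natPair hg hh)))

theorem computable_memN (hf : Computable f) (hg : Computable g) :
    Computable fun a => memN (f a) (g a) :=
  Computable.succ.comp (computable_natPair (Computable.const 2) (computable_natPair hf hg))

theorem computable_neqN (hf : Computable f) (hg : Computable g) :
    Computable fun a => neqN (f a) (g a) :=
  Computable.succ.comp (computable_natPair (Computable.const 3) (computable_natPair hf hg))

theorem computable_notN (hf : Computable f) : Computable fun a => notN (f a) :=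
  computable_nandN hf hf

theorem computable_satAtN (hf : Computable f) (hg : Computable g) :
    Computable fun a => satAtN (f a) (g a) :=
  computable_satN (computable_left hf) (computable_left (computable_right hf))
    (computable_natPair hg (computable_right (computable_right hf)))

variable {R : ℕ → ℕ → Bool} (hR : Computable₂ R)

include hR

theorem computable_guard {σ : α → ℕ} (hf : Computable f) (hg : Computable g) (hσ : Computable σ) :
    Computable fun a => bif R (f a) (g a) then σ a else 0 :=
  Computable.cond (hR.comp hf hg) hσ (Computable.const 0)

theorem computable_childSat (hf : Computable f) (hg : Computable g) :
    Computable fun a => childSat R (f a) (g a) := by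
  have ha := computable_left hf
  have hφ := computable_left (computable_right hf)
  have hv := computable_right (computable_right hf)
  have hm := computable_div hφ 3
  have hs := computable_entry (computable_left hm) hv
  have ht := computable_entry (computable_right hm) hv
  exact Computable.cond (computable_beq (computable_mod hφ 3) 0)
    (Computable.cond (Primrec.and.to_comp.comp (hR.comp (computable_lev hs) ha)
      (hR.comp (computable_lev ht) ha)) (computable_memN hs ht) (Computable.const 0))
    (Computable.cond (computable_beq (computable_mod hφ 3) 1)
      (Computable.cond (computable_beq hg 0) (computable_satN ha (computable_left hm) hv)
        (computable_satN ha (computable_right hm) hv))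
      (computable_guard hR (computable_lev hg) ha
        (computable_satN ha hm (computable_natPair hg hv))))

theorem computable_childMem (hf : Computable f) (hg : Computable g) (hh : Computable h) :
    Computable fun a => childMem R (f a) (g a) (h a) :=
  computable_guard hR (computable_lev hh) (computable_lev hg)
    (computable_nandN (computable_notN (computable_neqN hf hh)) (computable_satAtN hg hh))

theorem computable_inclN (hf : Computable f) (hg : Computable g) (hh : Computable h) :
    Computable fun a => inclN R (f a) (g a) (h a) :=
  computable_guard hR (computable_lev hh) (computable_lev hf)
    (computable_nandN (computable_satAtN hf hh) (computable_notN (computable_memN hh hg)))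

theorem computable_childNeq (hf : Computable f) (hg : Computable g) (hh : Computable h) :
    Computable fun a => childNeq R (f a) (g a) (h a) :=
  Computable.cond (computable_beq (computable_left hh) 0)
    (computable_inclN hR hf hg (computable_right hh))
    (computable_inclN hR hg hf (computable_right hh))

theorem computable_child : Computable₂ (child R) := by
  have hk : Computable fun q : ℕ × ℕ => q.1.unpair.1 := computable_left Computable.fst
  have hd : Computable fun q : ℕ × ℕ => q.1.unpair.2 := computable_right Computable.fst
  have hi : Computable fun q : ℕ × ℕ => q.2 := Computable.snd
  exact Computable.cond (computable_beq hk 0)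
    (Computable.cond (computable_beq hi 0) (computable_left hd) (computable_right hd))
    (Computable.cond (computable_beq hk 1) (computable_childSat hR hd hi)
      (Computable.cond (computable_beq hk 2)
        (computable_childMem hR (computable_left hd) (computable_right hd) hi)
        (computable_childNeq hR (computable_left hd) (computable_right hd) hi)))

end Computability

/-! ### Defining the natural numbers -/

/-- The code of `φ ∨ χ`. -/
def orC (φ χ : ℕ) : ℕ := nandC (notC φ) (notC χ)

/-- The code of `φ ↔ χ`. -/
def iffC (φ χ : ℕ) : ℕ := andC (impC φ χ) (impC χ φ)

/-- The code of a formula saying that `x₀` is the `k`-th von Neumann natural number: `x₀` is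
empty if `k = 0`, and it is the successor of the `(k - 1)`-st number otherwise. -/
def numC (k : ℕ) : ℕ :=
  (fun c => exC (andC c (allC (iffC (memC 0 2) (orC (memC 0 1) (eqC 0 1))))))^[k] (allC (nmemC 0 1))

theorem sat_numC {A : ZFSet.{0}} (hA : A.IsTransitive) (k : ℕ) :
    ∀ {e : ℕ → ZFSet.{0}}, e 0 ∈ A →
      (Sat A (numC k) e ↔ e 0 = Ordinal.toZFSet ((k : ℕ) : Ordinal.{0})) := by
  induction k with
  | zero =>
    intro e he
    simp only [numC, Function.iterate_zero, id, Nat.cast_zero, Ordinal.toZFSet_zero, sat_allC,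
      sat_nmemC, cons_zero, cons_succ, ZFSet.eq_empty]
    exact ⟨fun h z hz => (h z (hA.mem_trans hz he)).2.2 hz, fun h z hz => ⟨hz, he, h z⟩⟩
  | succ k ih =>
    intro e he
    have hbody : ∀ y ∈ A,
        (Sat A (allC (iffC (memC 0 2) (orC (memC 0 1) (eqC 0 1)))) (cons y e) ↔
          e 0 = insert y y) := by
      intro y hy
      have h1 : ∀ z ∈ A, (Sat A (iffC (memC 0 2) (orC (memC 0 1) (eqC 0 1)))
          (cons z (cons y e)) ↔ (z ∈ e 0 ↔ z ∈ (insert y y : ZFSet.{0}))) := by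
        intro z hz
        simp only [iffC, orC, sat_andC, sat_impC, sat_nandC, sat_notC]
        rw [sat_memC (by simpa) (by simpa), sat_memC (by simpa) (by simpa),
          sat_eqC hA (by simpa) (by simpa)]
        simp only [cons_zero, cons_succ, ZFSet.mem_insert_iff]
        tauto
      rw [sat_allC]
      constructor
      · intro h
        ext z
        constructor
        · intro hz
          have hzA := hA.mem_trans hz he
          exact ((h1 z hzA).1 (h z hzA)).1 hz
        · intro hz
          have hzA : z ∈ A := by
            rcases ZFSet.mem_insert_iff.1 hz with rfl | hz
            · exact hy
            · exact hA.mem_trans hz hy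
          exact ((h1 z hzA).1 (h z hzA)).2 hz
      · intro h z hz
        rw [h1 z hz, h]
    rw [numC, Function.iterate_succ_apply', ← numC, sat_exC, Nat.cast_succ,
      Ordinal.toZFSet_add_one]
    constructor
    · rintro ⟨y, hy, h⟩
      rw [sat_andC, hbody y hy, ih (by simpa)] at h
      rw [h.2, ← h.1]
      rfl
    · intro h
      have hy : Ordinal.toZFSet (k : Ordinal.{0}) ∈ A :=
        hA.mem_trans (by rw [h]; exact ZFSet.mem_insert _ _) he
      refine ⟨_, hy, ?_⟩
      rw [sat_andC, hbody _ hy, ih (by simpa)]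
      exact ⟨rfl, h⟩

theorem primrec_andC : Primrec₂ andC := by
  have hnand : Primrec₂ nandC :=
    Primrec.succ.comp (Primrec.nat_mul.comp (Primrec.const 3) Primrec₂.natPair)
  have hnot : Primrec notC := hnand.comp Primrec.id Primrec.id
  exact hnot.comp hnand

theorem primrec_exC : Primrec exC := by
  have hnand : Primrec₂ nandC :=
    Primrec.succ.comp (Primrec.nat_mul.comp (Primrec.const 3) Primrec₂.natPair)
  exact Primrec.succ.comp (Primrec.succ.comp
    (Primrec.nat_mul.comp (Primrec.const 3) (hnand.comp Primrec.id Primrec.id)))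

theorem primrec_numC : Primrec numC :=
  Primrec.nat_iterate Primrec.id (Primrec.const _)
    (primrec_exC.comp (primrec_andC.comp Primrec.snd (Primrec.const _)))

/-! ### Levels below the first non-recursive ordinal -/

/-- For a recursive ordinal `α`, the relation is the given well-ordering of type `α`, shifted by
one, with a new top element `0`. -/
theorem IsRecursiveOrdinal.exists_rankedRel {α : Ordinal.{0}} (h : IsRecursiveOrdinal α) :
    ∃ W : RankedRel, Computable₂ W.R ∧ W.rk 0 = α := by
  classical
  obtain ⟨D, r, ⟨_, hD⟩, ⟨_, hr⟩, wo, rfl⟩ := h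
  let rD : D → D → Prop := fun a b => r a b
  have : IsWellOrder D rD := wo
  let R : ℕ → ℕ → Bool := fun b a =>
    bif b == 0 then false else bif a == 0 then decide (b - 1 ∈ D) else
      (decide (b - 1 ∈ D) && decide (a - 1 ∈ D)) && decide (r (b - 1) (a - 1))
  let rk : ℕ → Ordinal.{0} := fun a => if a = 0 then Ordinal.type rD else
    if ha : a - 1 ∈ D then Ordinal.typein rD ⟨a - 1, ha⟩ else 0
  refine ⟨⟨R, rk, fun {b a} hba => ?_, fun {γ a} hγ => ?_⟩, ?_, rfl⟩
  · rcases b with _ | b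
    · simp [R] at hba
    rcases a with _ | a
    · have hb : b ∈ D := by simpa [R] using hba
      simpa [rk, hb] using Ordinal.typein_lt_type rD ⟨b, hb⟩
    · have hb : (b ∈ D ∧ a ∈ D) ∧ r b a := by simpa [R] using hba
      simpa [rk, hb.1.1, hb.1.2] using (Ordinal.typein_lt_typein rD (a := ⟨b, hb.1.1⟩)
        (b := ⟨a, hb.1.2⟩)).2 hb.2
  · rcases a with _ | a
    · obtain ⟨⟨b, hb⟩, rfl⟩ := Ordinal.typein_surj rD
        (show γ < Ordinal.type rD by simpa [rk] using hγ)
      exact ⟨b + 1, by simpa [R] using hb, by simp [rk, hb]⟩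
    · by_cases ha : a ∈ D
      · have hγ' : γ < Ordinal.typein rD ⟨a, ha⟩ := by simpa [rk, ha] using hγ
        obtain ⟨⟨b, hb⟩, rfl⟩ := Ordinal.typein_surj rD (hγ'.trans (Ordinal.typein_lt_type rD _))
        have hba : r b a := (Ordinal.typein_lt_typein rD).1 hγ'
        exact ⟨b + 1, by simp [R, hb, ha, hba], by simp [rk, hb]⟩
      · simp [rk, ha] at hγ
  · have hp : Computable fun q : ℕ × ℕ => q.1 - 1 := Computable.pred.comp Computable.fst
    have hp' : Computable fun q : ℕ × ℕ => q.2 - 1 := Computable.pred.comp Computable.snd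
    have hDc : ∀ {f : ℕ × ℕ → ℕ}, Computable f → Computable fun q => decide (f q ∈ D) :=
      fun hf => (hD.comp hf).of_eq fun _ => by congr
    have hrc : Computable fun q : ℕ × ℕ => decide (r (q.1 - 1) (q.2 - 1)) :=
      (hr.comp (hp.pair hp')).of_eq fun _ => by congr
    exact Computable.cond (computable_beq Computable.fst 0) (Computable.const false)
      (Computable.cond (computable_beq Computable.snd 0) (hDc hp)
        (Primrec.and.to_comp.comp (Primrec.and.to_comp.comp (hDc hp) (hDc hp')) hrc))

theorem mem_natSet {Q : Set ℕ} {y : ℕ} :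
    Ordinal.toZFSet ((y : ℕ) : Ordinal.{0}) ∈ natSet Q ↔ y ∈ Q := by
  rw [natSet, ZFSet.mem_range]
  constructor
  · rintro ⟨⟨n, hn⟩, h⟩
    obtain rfl : n = y := Nat.cast_injective (Ordinal.toZFSet_injective h)
    exact hn
  · exact fun h => ⟨⟨y, h⟩, rfl⟩

/-- Membership in a hyperarithmetical set is expressed by a computable sequence of sentences. -/
theorem Hyperarithmetical.exists_sentences {Q : Set ℕ} (hQ : Hyperarithmetical Q) :
    ∃ W : RankedRel, Computable₂ W.R ∧ ∃ σ : ℕ → ℕ, Computable σ ∧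
      ∀ X, IsEvaluation (child W.R) X → ∀ y, Decides X (σ y) (y ∈ Q) := by
  obtain ⟨β, hβ, hmem⟩ := mem_constructible.1 hQ
  have hrec : IsRecursiveOrdinal β := by
    by_contra h
    exact (csInf_le' (s := {α : Ordinal.{0} | ¬ IsRecursiveOrdinal α}) h).not_gt hβ
  obtain ⟨W, hR, rfl⟩ := hrec.exists_rankedRel
  have hT := W.isTransitive_L 0
  obtain ⟨l, c, hl, hc⟩ := exists_sat_of_mem_definablePowerset hT hmem
  obtain ⟨v, hv⟩ := W.exists_env_eq (fun z => W.mem_L_iff.1) l hl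
  refine ⟨W, hR, fun y => satN 0 (exC (andC (numC y) c)) v, ?_, fun X hX y => ?_⟩
  · exact computable_satN (Computable.const 0)
      (primrec_exC.comp (primrec_andC.comp primrec_numC (Primrec.const c))).to_comp
      (Computable.const v)
  · refine (hX.decides_satN 0 _ v).congr ?_
    rw [sat_exC, ← mem_natSet]
    constructor
    · rintro ⟨z, hz, h⟩
      rw [sat_andC, sat_numC hT y (by simpa), ← hc _ hv z hz] at h
      exact h.1 ▸ h.2
    · intro h
      have hz := definablePowerset_subset hmem h
      refine ⟨_, hz, ?_⟩
      rw [sat_andC, sat_numC hT y (by simpa), ← hc _ hv _ hz]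
      exact ⟨rfl, h⟩

end PosFix

theorem theorem1 (pr : ℕ → ℕ → ℕ) (pr_inj : Function.Injective2 pr) (p : ℕ)
    (hp : ∀ i j : ℕ, PosFix.rfn p (Nat.pair i j) = Part.some (pr i j)) :
    PosFix.Positive (PosFix.psi p) ∧
    (∀ (y : ℕ) (Q : Set ℕ), PosFix.Holds (PosFix.psi p) ![y] Q ↔
      ∃ a b e : ℕ, y = pr a b ∧
        ((a = pr 0 e ∧ b = e) ∨
          (a = pr 1 e ∧ ∃ t : ℕ, ∀ s : ℕ, ∃ v ∈ PosFix.rfn e (pr t s), pr v b ∈ Q))) ∧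
    ∀ Q : Set ℕ, PosFix.IsFixedPoint (PosFix.psi p) Q → ¬ PosFix.Hyperarithmetical Q := by
  refine ⟨PosFix.positive_psi p, PosFix.holds_psi hp, fun Q hfix hQ => ?_⟩
  obtain ⟨W, hR, σ, hσ, hdec⟩ := hQ.exists_sentences
  obtain ⟨h, hh, hX⟩ := PosFix.exists_sections pr_inj hp (PosFix.computable_child hR)
  obtain ⟨a, ha⟩ := PosFix.exists_diagonal_section pr_inj hp
    (τ := fun t => h false (σ (pr t t)))
    (hh.comp (Computable.const false)
      (hσ.comp ((PosFix.computable_pr hp).comp Computable.id Computable.id)))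
  -- The section with code `a` is `{t | pr t t ∉ Q}`.
  have h₁ := ha Q hfix a
  have h₂ := (hdec _ (hX Q hfix a) (pr a a)).2
  exact iff_not_self (h₁.trans h₂)
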